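/- Let $q=e^{2\pi i/8}$, $q^z=e^{\pi i z/4}$, $\{z\}=q^z-q^{-z}$, $[z]=\{z\}/\{1\}$, and consider finite-dimensional weight modules of the unrolled restricted quantum group $\overline{U}^H_q(\mathfrak{sl}_2)$: generators $E,F,H$ and $K=q^H$ with $[H,E]=2E$, $[H,F]=-2F$, $[E,F]=\frac{K-K^{-1}}{q-q^{-1}}$, $E^4=F^4=0$, and coproduct $\Delta E=1\otimes E+E\otimes K$, $\Delta F=K^{-1}\otimes F+F\otimes 1$, $\Delta H=H\otimes 1+1\otimes H$. Modules are braided by $c_{V,W}=\tau\circ R$, where $\tau$ is the flip and $R=q^{H\otimes H/2}\sum_{n=0}^{3}\frac{\{1\}^{2n}}{\{n\}!}q^{n(n-1)/2}E^n\otimes F^n$. For real $\beta\notin\mathbb Z$ let $V_\beta$ (the neglecton $\beta$) have basis $v_0,\dots,v_3$ with $Hv_i=(\beta+3-2i)v_i$, $Ev_i=[i][i-\beta]v_{i-1}$, $Fv_i=v_{i+1}$ (where $v_{-1}=v_4=0$). Let $S_1$ (the Ising anyon $1$) have basis $s_0,s_1$ of weights $1,-1$ with $Es_1=s_0$, $Fs_0=s_1$,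 $Es_0=Fs_1=0$. Let $\alpha\in\mathbb R\setminus\mathbb Z$ and let $\mathcal H_1=\mathrm{Hom}(V_\alpha,V_\alpha\otimes S_1\otimes S_1)$ be the one-qubit space. It is two-dimensional, with basis the fusion trees $|0\rangle=(Y^{\alpha 1}_{\alpha+1}\otimes\mathrm{Id})\,Y^{(\alpha+1)1}_{\alpha}$ and $|1\rangle=(Y^{\alpha 1}_{\alpha-1}\otimes\mathrm{Id})\,Y^{(\alpha-1)1}_{\alpha}$, where $Y^{\beta 1}_{\beta\pm1}:V_{\beta\pm1}\to V_\beta\otimes S_1$ is the module map with $v_0\mapsto v_0\otimes s_0$, respectively $v_0\mapsto v_0\otimes s_1-\frac{1}{q[1-\beta]}v_1\otimes s_0$. The affine braid generators act on $\mathcal H_1$ by post-composition: $J_1=\mathsf b_1^2$ with $(c_{S_1,V_\alpha}c_{V_\alpha,S_1})\otimes\mathrm{Id}_{S_1}$, and $\mathsf b_2$ with $\mathrm{Id}_{V_\alpha}\otimes c_{S_1,S_1}$. The inner products are $\langle i|j\rangle=\mathsf t(|i\rangle^\dagger|j\rangle)$. Here $\mathsf t(c\,\mathrm{Id}_{V_\alpha})=c\,\mathsf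 d_\alpha$ with $\mathsf d_\alpha=-4\{\alpha\}/\{4\alpha\}$, and the adjoint $|i\rangle^\dagger$ is the reflected tree, built from the adjoints of the maps $Y$ for the following Hermitian forms. The form of $V_\beta$ is the diagonal one with $\langle v_i,v_i\rangle=\prod_{k=1}^{i}[k][k-\beta]$. The form of $S_1$ makes $s_0,s_1$ orthonormal. The form of $V_\beta\otimes S_1$ is $\langle x,\tau X y\rangle$, where $\langle\cdot,\cdot\rangle$ is the product form and $X=(\sqrt\theta_{S_1\otimes V_\beta})^{-1}c_{V_\beta,S_1}(\sqrt\theta_{V_\beta}\otimes\sqrt\theta_{S_1})$; the map $\sqrt\theta$ is the scalar $q^{(\beta^2-9)/4}$ on $V_\beta$ and $q^{-5/4}$ on $S_1$, and on $S_1\otimes V_\beta\cong V_{\beta+1}\oplus V_{\beta-1}$ it acts on each summand by that summand's scalar. Let $M=\mathrm{diag}(\sqrt{\langle 0|0\rangle},\sqrt{\langle 1|1\rangle})$ (principal square roots), and let $J_1^{\mathrm{norm}}$ and $\mathsf b_2^{\mathrm{norm}}$ be the conjugates $M(\cdot)M^{-1}$ of the matrices of $J_1$ and $\mathsf b_2$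 in the basis $|0\rangle,|1\rangle$. **Theorem.** Let $\alpha\in\mathbb R\setminus\mathbb Z$ be such that $J_1^{\mathrm{norm}}$ and $\mathsf b_2^{\mathrm{norm}}$ are unitary $2\times2$ matrices (in the usual sense), and suppose that $\alpha\not\equiv 2\pm\frac23$ and $\alpha\not\equiv 2\pm\frac35 \pmod 4$. Then the rescaled matrices $-q\,J_1^{\mathrm{norm}}$ and $q^{-3/2}\,\mathsf b_2^{\mathrm{norm}}$ lie in $SU(2)$ and generate a dense subgroup of $SU(2)$. -/

import Mathlib

open scoped Kronecker Matrix

namespace NonssIsing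

noncomputable section

/-- `qpow z = q ^ z` for `q = exp (2 π i / 8)`, that is `exp (π i z / 4)`. -/
def qpow (z : ℂ) : ℂ := Complex.exp (z * (Real.pi * Complex.I / 4))

/-- `{z} = q ^ z - q ^ (-z)`. -/
def qbr (z : ℂ) : ℂ := qpow z - qpow (-z)

/-- `[z] = {z} / {1}`. -/
def qnum (z : ℂ) : ℂ := qbr z / qbr 1

/-- `{n}! = {n} {n - 1} ⋯ {1}`. -/
def qfact (n : ℕ) : ℂ := ∏ k ∈ Finset.range n, qbr (k + 1)

theorem qpow_add (x y : ℂ) : qpow (x + y) = qpow x * qpow y := by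
  simp [qpow, add_mul, Complex.exp_add]

theorem qpow_zero : qpow 0 = 1 := by simp [qpow]

theorem qpow_ne_zero (x : ℂ) : qpow x ≠ 0 := Complex.exp_ne_zero _

theorem qpow_neg (x : ℂ) : qpow (-x) = (qpow x)⁻¹ := by
  simp [qpow, Complex.exp_neg]

theorem qpow_two : qpow 2 = Complex.I := by
  rw [qpow, show (2 : ℂ) * (Real.pi * Complex.I / 4) = Real.pi / 2 * Complex.I by ring,
    Complex.exp_pi_div_two_mul_I]

theorem qpow_one_sq : qpow 1 ^ 2 = Complex.I := by
  rw [← qpow_two, sq, ← qpow_add]; norm_num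

theorem qpow_one_pow_four : qpow 1 ^ 4 = -1 := by
  rw [show (4 : ℕ) = 2 * 2 from rfl, pow_mul, qpow_one_sq, Complex.I_sq]

theorem qpow_eq_one_iff (z : ℂ) : qpow z = 1 ↔ ∃ n : ℤ, z = 8 * n := by
  rw [qpow, Complex.exp_eq_one_iff]
  have hpi : (Real.pi : ℂ) ≠ 0 := by exact_mod_cast Real.pi_ne_zero
  have hI := Complex.I_ne_zero
  constructor
  · rintro ⟨n, hn⟩
    refine ⟨n, ?_⟩
    have : (Real.pi * Complex.I) * (z - 8 * n) = 0 := by linear_combination 4 * hn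
    rcases mul_eq_zero.1 this with h | h
    · exact absurd h (mul_ne_zero hpi hI)
    · linear_combination h
  · rintro ⟨n, rfl⟩
    exact ⟨n, by ring⟩

theorem qbr_ne_zero {x : ℝ} (hx : ∀ n : ℤ, x ≠ n) : qbr x ≠ 0 := by
  intro h
  have h1 : qpow (2 * x) = 1 := by
    have h2 : qpow x = qpow (-x) := sub_eq_zero.1 h
    rw [two_mul, qpow_add]
    nth_rewrite 1 [h2]
    rw [← qpow_add]
    simp [qpow_zero]
  obtain ⟨n, hn⟩ := (qpow_eq_one_iff _).1 h1
  refine hx (4 * n) ?_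
  have : ((2 * x : ℝ) : ℂ) = ((8 * n : ℝ) : ℂ) := by push_cast; exact hn
  have := Complex.ofReal_injective this
  push_cast
  linarith

theorem qbr_one_ne_zero : qbr 1 ≠ 0 := by
  intro h
  have h2 : qpow 1 = qpow (-1) := sub_eq_zero.1 h
  have h3 : qpow 2 = 1 := by
    rw [show (2 : ℂ) = 1 + 1 by norm_num, qpow_add]
    nth_rewrite 1 [h2]
    rw [← qpow_add]
    simp [qpow_zero]
  rw [qpow_two] at h3
  have := congrArg Complex.re h3
  simp at this

/-! ### Weight modules of the unrolled quantum group -/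

/-- A finite-dimensional weight module of the unrolled restricted quantum group of `sl₂` at
`q = exp (2 π i / 8)` with real weights, written in a basis of weight vectors indexed by `ι`:
the generator `H` acts as the diagonal matrix of the weights, `K = q ^ H`, and `E`, `F` act
by matrices subject to `[H, E] = 2 E`, `[H, F] = - 2 F`,
`[E, F] = (K - K⁻¹) / (q - q⁻¹)` and `E ^ 4 = F ^ 4 = 0`. -/
structure WeightModule (ι : Type) [Fintype ι] [DecidableEq ι] where
  wt : ι → ℝ
  E : Matrix ι ι ℂ
  F : Matrix ι ι ℂ
  wt_E : Matrix.diagonal (fun i => (wt i : ℂ)) * E - E * Matrix.diagonal (fun i => (wt i : ℂ))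
    = (2 : ℂ) • E
  wt_F : Matrix.diagonal (fun i => (wt i : ℂ)) * F - F * Matrix.diagonal (fun i => (wt i : ℂ))
    = (-2 : ℂ) • F
  comm : E * F - F * E = (qbr 1)⁻¹ • (Matrix.diagonal (fun i => qpow (wt i))
    - Matrix.diagonal (fun i => qpow (-(wt i))))
  E_nil : E ^ 4 = 0
  F_nil : F ^ 4 = 0

namespace WeightModule

variable {ι κ : Type} [Fintype ι] [DecidableEq ι] [Fintype κ] [DecidableEq κ]

/-- The action of `H`. -/
def H (M : WeightModule ι) : Matrix ι ι ℂ := Matrix.diagonal fun i => (M.wt i : ℂ)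

/-- The action of `K = q ^ H`. -/
def K (M : WeightModule ι) : Matrix ι ι ℂ := Matrix.diagonal fun i => qpow (M.wt i)

/-- The action of `K⁻¹`. -/
def Kinv (M : WeightModule ι) : Matrix ι ι ℂ := Matrix.diagonal fun i => qpow (-(M.wt i))

theorem wt_of_E (M : WeightModule ι) {i j : ι} (h : M.E i j ≠ 0) : M.wt i = M.wt j + 2 := by
  have h1 := congrFun (congrFun M.wt_E i) j
  simp only [Matrix.sub_apply, Matrix.diagonal_mul, Matrix.mul_diagonal, Matrix.smul_apply,
    smul_eq_mul] at h1
  have h2 : ((M.wt i : ℂ) - M.wt j - 2) * M.E i j = 0 := by linear_combination h1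
  have h3 := (mul_eq_zero.1 h2).resolve_right h
  have h4 : ((M.wt i - M.wt j - 2 : ℝ) : ℂ) = 0 := by push_cast; exact h3
  have := Complex.ofReal_eq_zero.1 h4
  linarith

theorem wt_of_F (M : WeightModule ι) {i j : ι} (h : M.F i j ≠ 0) : M.wt i = M.wt j - 2 := by
  have h1 := congrFun (congrFun M.wt_F i) j
  simp only [Matrix.sub_apply, Matrix.diagonal_mul, Matrix.mul_diagonal, Matrix.smul_apply,
    smul_eq_mul] at h1
  have h2 : ((M.wt i : ℂ) - M.wt j + 2) * M.F i j = 0 := by linear_combination h1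
  have h3 := (mul_eq_zero.1 h2).resolve_right h
  have h4 : ((M.wt i - M.wt j + 2 : ℝ) : ℂ) = 0 := by push_cast; exact h3
  have := Complex.ofReal_eq_zero.1 h4
  linarith

theorem K_mul_E (M : WeightModule ι) : M.K * M.E = qpow 2 • (M.E * M.K) := by
  ext i j
  simp only [K, Matrix.diagonal_mul, Matrix.mul_diagonal, Matrix.smul_apply, smul_eq_mul]
  by_cases h : M.E i j = 0
  · simp [h]
  · rw [M.wt_of_E h]; push_cast; rw [qpow_add]; ring

theorem Kinv_mul_E (M : WeightModule ι) : M.E * M.Kinv = qpow 2 • (M.Kinv * M.E) := by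
  ext i j
  simp only [Kinv, Matrix.diagonal_mul, Matrix.mul_diagonal, Matrix.smul_apply, smul_eq_mul]
  by_cases h : M.E i j = 0
  · simp [h]
  · rw [M.wt_of_E h]; push_cast
    rw [show -((M.wt j : ℂ)) = 2 + -(M.wt j + 2) by ring, qpow_add]; ring

theorem F_mul_K (M : WeightModule ι) : M.F * M.K = qpow 2 • (M.K * M.F) := by
  ext i j
  simp only [K, Matrix.diagonal_mul, Matrix.mul_diagonal, Matrix.smul_apply, smul_eq_mul]
  by_cases h : M.F i j = 0
  · simp [h]
  · rw [M.wt_of_F h]; push_cast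
    rw [show (M.wt j : ℂ) = 2 + (M.wt j - 2) by ring, qpow_add]; ring_nf

theorem Kinv_mul_F (M : WeightModule ι) : M.Kinv * M.F = qpow 2 • (M.F * M.Kinv) := by
  ext i j
  simp only [Kinv, Matrix.diagonal_mul, Matrix.mul_diagonal, Matrix.smul_apply, smul_eq_mul]
  by_cases h : M.F i j = 0
  · simp [h]
  · rw [M.wt_of_F h]; push_cast
    rw [show -((M.wt j : ℂ) - 2) = 2 + -(M.wt j) by ring, qpow_add]; ring

theorem pow_four_add {R : Type} [Ring R] [Algebra ℂ R] {x y : R}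
    (h : y * x = Complex.I • (x * y)) (hx : x ^ 4 = 0) (hy : y ^ 4 = 0) : (x + y) ^ 4 = 0 := by
  have hI : Complex.I * Complex.I = -1 := Complex.I_mul_I
  have h2 : (x + y) ^ 2 = x ^ 2 + (1 + Complex.I) • (x * y) + y ^ 2 := by
    rw [sq, add_mul, mul_add, mul_add, h, add_smul, one_smul, sq, sq]; abel
  have a1 : y * x ^ 2 = (-1 : ℂ) • (x ^ 2 * y) := by
    rw [sq, ← mul_assoc, h, smul_mul_assoc, mul_assoc, h, mul_smul_comm, smul_smul, hI, mul_assoc]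
  have a2 : y ^ 2 * x = (-1 : ℂ) • (x * y ^ 2) := by
    rw [sq, mul_assoc, h, mul_smul_comm, ← mul_assoc, h, smul_mul_assoc, smul_smul, hI, mul_assoc]
  have a3 : y ^ 2 * x ^ 2 = x ^ 2 * y ^ 2 := by
    rw [sq x, ← mul_assoc, a2, smul_mul_assoc, mul_assoc, a2, mul_smul_comm, smul_smul]
    norm_num [mul_assoc]
  have b1 : x * y * (x ^ 2) = (-1 : ℂ) • (x ^ 3 * y) := by
    rw [mul_assoc, a1, mul_smul_comm, ← mul_assoc, ← pow_succ']
  have b2 : x * y * (x * y) = Complex.I • (x ^ 2 * y ^ 2) := by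
    rw [mul_assoc, ← mul_assoc y, h, smul_mul_assoc, mul_smul_comm, sq, sq]
    simp only [mul_assoc]
  have b3 : y ^ 2 * (x * y) = (-1 : ℂ) • (x * y ^ 3) := by
    rw [← mul_assoc, a2, smul_mul_assoc, mul_assoc, ← pow_succ]
  have b4 : x ^ 2 * (x * y) = x ^ 3 * y := by rw [← mul_assoc, ← pow_succ]
  have b5 : x * y * y ^ 2 = x * y ^ 3 := by rw [mul_assoc, ← pow_succ']
  rw [show (4 : ℕ) = 2 * 2 from rfl, pow_mul, h2, sq (x ^ 2 + _ + _)]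
  simp only [add_mul, mul_add, smul_mul_assoc, mul_smul_comm, smul_smul, b1, b2, b3, b4, b5, a3,
    ← pow_add, hx, hy]
  have hc : (1 + Complex.I) * (1 * Complex.I + Complex.I * Complex.I) = -2 := by
    linear_combination (2 + Complex.I) * hI
  simp only [smul_add, smul_smul, hc]
  module

/-- The tensor product of weight modules, by the coproduct `Δ E = 1 ⊗ E + E ⊗ K`,
`Δ F = K⁻¹ ⊗ F + F ⊗ 1`, `Δ H = H ⊗ 1 + 1 ⊗ H`. -/
def tensor (M : WeightModule ι) (N : WeightModule κ) : WeightModule (ι × κ) where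
  wt p := M.wt p.1 + N.wt p.2
  E := 1 ⊗ₖ N.E + M.E ⊗ₖ N.K
  F := M.Kinv ⊗ₖ N.F + M.F ⊗ₖ 1
  wt_E := by
    ext ⟨i, k⟩ ⟨j, l⟩
    have h1 := congrFun (congrFun N.wt_E k) l
    have h2 := congrFun (congrFun M.wt_E i) j
    simp only [Matrix.sub_apply, Matrix.diagonal_mul, Matrix.mul_diagonal, Matrix.smul_apply,
      smul_eq_mul] at h1 h2
    simp only [Matrix.sub_apply, Matrix.diagonal_mul, Matrix.mul_diagonal, Matrix.smul_apply,
      smul_eq_mul, Matrix.add_apply, Matrix.kroneckerMap_apply, K, Matrix.one_apply,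
      Matrix.diagonal_apply]
    push_cast
    by_cases h3 : i = j <;> by_cases h4 : k = l
    · subst h3 h4
      simp only [if_true]
      linear_combination h1 + qpow (N.wt k) * h2
    · subst h3
      simp only [if_true, h4, if_false]
      linear_combination h1
    · subst h4
      simp only [if_true, h3, if_false]
      linear_combination qpow (N.wt k) * h2
    · simp [h3, h4]
  wt_F := by
    ext ⟨i, k⟩ ⟨j, l⟩
    have h1 := congrFun (congrFun N.wt_F k) l
    have h2 := congrFun (congrFun M.wt_F i) j
    simp only [Matrix.sub_apply, Matrix.diagonal_mul, Matrix.mul_diagonal, Matrix.smul_apply,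
      smul_eq_mul] at h1 h2
    simp only [Matrix.sub_apply, Matrix.diagonal_mul, Matrix.mul_diagonal, Matrix.smul_apply,
      smul_eq_mul, Matrix.add_apply, Matrix.kroneckerMap_apply, Kinv, Matrix.one_apply,
      Matrix.diagonal_apply]
    push_cast
    by_cases h3 : i = j <;> by_cases h4 : k = l
    · subst h3 h4
      simp only [if_true]
      linear_combination qpow (-(M.wt i)) * h1 + h2
    · subst h3
      simp only [if_true, h4, if_false]
      linear_combination qpow (-(M.wt i)) * h1
    · subst h4
      simp only [if_true, h3, if_false]
      linear_combination h2
    · simp [h3, h4]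
  comm := by
    have hM : M.E * M.F - M.F * M.E = (qbr 1)⁻¹ • (M.K - M.Kinv) := M.comm
    have hN : N.E * N.F - N.F * N.E = (qbr 1)⁻¹ • (N.K - N.Kinv) := N.comm
    have e1 : (Matrix.diagonal fun p : ι × κ => qpow ((M.wt p.1 + N.wt p.2 : ℝ) : ℂ))
        = M.K ⊗ₖ N.K := by
      simp only [K, Matrix.diagonal_kronecker_diagonal]
      congr 1; ext p; push_cast; rw [qpow_add]
    have e2 : (Matrix.diagonal fun p : ι × κ => qpow (-((M.wt p.1 + N.wt p.2 : ℝ) : ℂ)))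
        = M.Kinv ⊗ₖ N.Kinv := by
      simp only [Kinv, Matrix.diagonal_kronecker_diagonal]
      congr 1; ext p; push_cast; rw [neg_add, qpow_add]
    rw [e1, e2]
    simp only [add_mul, mul_add, ← Matrix.mul_kronecker_mul, one_mul, mul_one]
    have e3 : (M.E * M.Kinv) ⊗ₖ (N.K * N.F) = (M.Kinv * M.E) ⊗ₖ (N.F * N.K) := by
      rw [M.Kinv_mul_E, N.F_mul_K, Matrix.smul_kronecker, Matrix.kronecker_smul]
    rw [e3]
    have e4 : N.E * N.F = N.F * N.E + (qbr 1)⁻¹ • (N.K - N.Kinv) := by rw [← hN]; abel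
    have e5 : M.E * M.F = M.F * M.E + (qbr 1)⁻¹ • (M.K - M.Kinv) := by rw [← hM]; abel
    rw [e4, e5]
    have e6 : M.Kinv ⊗ₖ (N.K - N.Kinv) = M.Kinv ⊗ₖ N.K - M.Kinv ⊗ₖ N.Kinv := by
      ext p r; simp [mul_sub]
    have e7 : (M.K - M.Kinv) ⊗ₖ N.K = M.K ⊗ₖ N.K - M.Kinv ⊗ₖ N.K := by
      ext p r; simp [sub_mul]
    simp only [Matrix.kronecker_add, Matrix.add_kronecker, Matrix.smul_kronecker,
      Matrix.kronecker_smul, e6, e7]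
    module
  E_nil := by
    refine pow_four_add ?_ ?_ ?_
    · rw [← Matrix.mul_kronecker_mul, ← Matrix.mul_kronecker_mul, N.K_mul_E, ← qpow_two,
        Matrix.kronecker_smul, one_mul, mul_one]
    · simp only [pow_succ, pow_zero, one_mul, ← Matrix.mul_kronecker_mul]
      rw [show N.E * N.E * N.E * N.E = N.E ^ 4 by simp [pow_succ], N.E_nil]; simp
    · simp only [pow_succ, pow_zero, one_mul, ← Matrix.mul_kronecker_mul]
      rw [show M.E * M.E * M.E * M.E = M.E ^ 4 by simp [pow_succ], M.E_nil]; simp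
  F_nil := by
    rw [add_comm]
    refine pow_four_add ?_ ?_ ?_
    · rw [← Matrix.mul_kronecker_mul, ← Matrix.mul_kronecker_mul, M.Kinv_mul_F, ← qpow_two,
        Matrix.smul_kronecker, one_mul, mul_one]
    · simp only [pow_succ, pow_zero, one_mul, ← Matrix.mul_kronecker_mul]
      rw [show M.F * M.F * M.F * M.F = M.F ^ 4 by simp [pow_succ], M.F_nil]; simp
    · simp only [pow_succ, pow_zero, one_mul, ← Matrix.mul_kronecker_mul]
      rw [show N.F * N.F * N.F * N.F = N.F ^ 4 by simp [pow_succ], N.F_nil]; simp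

/-- `Hom(M, N)`: the linear maps that commute with the generators. -/
def Hom (M : WeightModule ι) (N : WeightModule κ) : Submodule ℂ (Matrix κ ι ℂ) where
  carrier := {f | N.E * f = f * M.E ∧ N.F * f = f * M.F ∧ N.H * f = f * M.H}
  add_mem' := by
    rintro f g ⟨h1, h2, h3⟩ ⟨h4, h5, h6⟩
    refine ⟨?_, ?_, ?_⟩ <;> rw [Matrix.mul_add, Matrix.add_mul]
    · rw [h1, h4]
    · rw [h2, h5]
    · rw [h3, h6]
  zero_mem' := ⟨by simp, by simp, by simp⟩
  smul_mem' := by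
    rintro c f ⟨h1, h2, h3⟩
    refine ⟨?_, ?_, ?_⟩ <;> rw [Matrix.mul_smul, Matrix.smul_mul]
    · rw [h1]
    · rw [h2]
    · rw [h3]

/-- The permutation `x ⊗ y ↦ y ⊗ x`. -/
def flip (ι κ : Type) [DecidableEq ι] [DecidableEq κ] : Matrix (κ × ι) (ι × κ) ℂ :=
  Matrix.of fun p r => if p.1 = r.2 ∧ p.2 = r.1 then 1 else 0

/-- The `R`-matrix
`q ^ (H ⊗ H / 2) ∑_{n < 4} {1} ^ (2 n) / {n}! q ^ (n (n - 1) / 2) E ^ n ⊗ F ^ n`. -/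
def Rmatrix (M : WeightModule ι) (N : WeightModule κ) : Matrix (ι × κ) (ι × κ) ℂ :=
  Matrix.diagonal (fun p => qpow (M.wt p.1 * N.wt p.2 / 2)) *
    ∑ n ∈ Finset.range 4, (qbr 1 ^ (2 * n) / qfact n * qpow (n * (n - 1) / 2)) •
      ((M.E ^ n) ⊗ₖ (N.F ^ n))

/-- The braiding `c_{M,N} : M ⊗ N → N ⊗ M`. -/
def braiding (M : WeightModule ι) (N : WeightModule κ) : Matrix (κ × ι) (ι × κ) ℂ :=
  flip ι κ * Rmatrix M N

end WeightModule

open WeightModule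

theorem qnum_shift (β : ℂ) (i : ℂ) :
    qnum (i + 1) * qnum (i + 1 - β) - qnum i * qnum (i - β)
      = (qbr 1)⁻¹ * (qpow (β + 3 - 2 * i) - qpow (-(β + 3 - 2 * i))) := by
  have h1 := qbr_one_ne_zero
  have h4 : qpow 4 = -1 := by
    rw [show (4 : ℂ) = 2 + 2 by norm_num, qpow_add, qpow_two, Complex.I_mul_I]
  have hx := qpow_ne_zero i
  have hy := qpow_ne_zero β
  have hq := qpow_ne_zero 1
  have h5 : qpow (β + 3 - 2 * i) = -(qpow (i + i + 1 - β))⁻¹ := by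
    rw [show β + 3 - 2 * i = 4 + -(i + i + 1 - β) by ring, qpow_add, h4, qpow_neg]; ring
  have h6 : qpow (-(β + 3 - 2 * i)) = -(qpow (i + i + 1 - β)) := by
    rw [qpow_neg, h5, inv_neg, inv_inv]
  have h7 : qnum (i + 1) * qnum (i + 1 - β) - qnum i * qnum (i - β)
      = (qbr 1)⁻¹ * ((qbr 1)⁻¹ * (qbr (i + 1) * qbr (i + 1 - β) - qbr i * qbr (i - β))) := by
    simp only [qnum]; field_simp
  have h8 : qbr (i + 1) * qbr (i + 1 - β) - qbr i * qbr (i - β)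
      = qbr 1 * (qpow (i + i + 1 - β) - (qpow (i + i + 1 - β))⁻¹) := by
    simp only [qbr, sub_eq_add_neg, neg_add, neg_neg, qpow_add, qpow_neg]
    field_simp
    ring
  rw [h5, h6, h7, h8, inv_mul_cancel_left₀ h1]
  ring

theorem qnum_four : qnum 4 = 0 := by
  have h : qpow 4 = qpow (-4) := by
    rw [show (4 : ℂ) = 2 + 2 by norm_num, qpow_neg, qpow_add, qpow_two, Complex.I_mul_I]
    norm_num
  simp [qnum, qbr, h]

theorem qnum_zero : qnum 0 = 0 := by simp [qnum, qbr]

theorem qnum_one : qnum 1 = 1 := div_self qbr_one_ne_zero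

/-- The `4`-dimensional module `V_β` with highest weight `β + 3`: basis `v₀, …, v₃`,
`H vᵢ = (β + 3 - 2 i) vᵢ`, `E vᵢ = [i] [i - β] vᵢ₋₁`, `F vᵢ = vᵢ₊₁`. -/
def V (β : ℝ) : WeightModule (Fin 4) where
  wt i := β + 3 - 2 * (i : ℕ)
  E := Matrix.of fun i j => if (i : ℕ) + 1 = j then qnum (j : ℕ) * qnum ((j : ℕ) - β) else 0
  F := Matrix.of fun i j => if (j : ℕ) + 1 = i then 1 else 0
  wt_E := by
    ext i j
    simp only [Matrix.sub_apply, Matrix.diagonal_mul, Matrix.mul_diagonal, Matrix.smul_apply,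
      smul_eq_mul, Matrix.of_apply]
    split_ifs with h
    · rw [← h]; push_cast; ring
    · simp
  wt_F := by
    ext i j
    simp only [Matrix.sub_apply, Matrix.diagonal_mul, Matrix.mul_diagonal, Matrix.smul_apply,
      smul_eq_mul, Matrix.of_apply]
    split_ifs with h
    · rw [← h]; push_cast; ring
    · simp
  comm := by
    have h0 := qnum_shift β 0
    have h1 := qnum_shift β 1
    have h2 := qnum_shift β 2
    have h3 := qnum_shift β 3
    simp only [qnum_zero] at h0
    norm_num [qnum_four] at h0 h1 h2 h3
    ext i j
    fin_cases i <;> fin_cases j <;>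
      norm_num [Matrix.mul_apply, Fin.sum_univ_four]
    · simpa using h0
    · exact h1
    · exact fun h => absurd h (by decide)
    · exact h2
    · exact h3
  E_nil := by
    ext i j
    fin_cases i <;> fin_cases j <;> simp [pow_succ, Matrix.mul_apply, Fin.sum_univ_four]
  F_nil := by
    ext i j
    fin_cases i <;> fin_cases j <;> simp [pow_succ, Matrix.mul_apply, Fin.sum_univ_four]

/-- The `2`-dimensional module `S₁` (the Ising anyon): basis `s₀, s₁` of weights `1, -1`,
`E s₁ = s₀`, `F s₀ = s₁`. -/
def S1 : WeightModule (Fin 2) where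
  wt i := if i = 0 then 1 else -1
  E := Matrix.of fun i j => if i = 0 ∧ j = 1 then 1 else 0
  F := Matrix.of fun i j => if i = 1 ∧ j = 0 then 1 else 0
  wt_E := by
    ext i j
    fin_cases i <;> fin_cases j <;>
      norm_num [Matrix.diagonal_mul, Matrix.mul_diagonal]
  wt_F := by
    ext i j
    fin_cases i <;> fin_cases j <;>
      norm_num [Matrix.diagonal_mul, Matrix.mul_diagonal]
  comm := by
    have h := qbr_one_ne_zero
    ext i j
    fin_cases i <;> fin_cases j <;> simp [Matrix.mul_apply]
    · rw [← qbr]; field_simp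
    · rw [← neg_sub, ← qbr]; field_simp
  E_nil := by
    ext i j
    fin_cases i <;> fin_cases j <;> simp [pow_succ, Matrix.mul_apply]
  F_nil := by
    ext i j
    fin_cases i <;> fin_cases j <;> simp [pow_succ, Matrix.mul_apply]


namespace WeightModule

variable {ι κ : Type} [Fintype ι] [DecidableEq ι] [Fintype κ] [DecidableEq κ]

theorem flip_mul (A : Matrix ι ι ℂ) (B : Matrix κ κ ℂ) :
    flip ι κ * (A ⊗ₖ B) = (B ⊗ₖ A) * flip ι κ := by
  ext ⟨k, i⟩ ⟨j, l⟩
  simp only [flip, Matrix.mul_apply, Matrix.of_apply, Matrix.kroneckerMap_apply,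
    Fintype.sum_prod_type, ite_mul, mul_ite, one_mul, mul_one, zero_mul, mul_zero, ite_and]
  simp [Finset.sum_ite_eq, mul_comm]

theorem Rmatrix_eq (M : WeightModule ι) (N : WeightModule κ) (h : M.E ^ 2 = 0 ∨ N.F ^ 2 = 0) :
    Rmatrix M N = Matrix.diagonal (fun p => qpow (M.wt p.1 * N.wt p.2 / 2)) *
      (1 + qbr 1 • (M.E ⊗ₖ N.F)) := by
  have h2 : (M.E ^ 2) ⊗ₖ (N.F ^ 2) = 0 := by
    rcases h with h | h <;> simp [h]
  have h3 : (M.E ^ 3) ⊗ₖ (N.F ^ 3) = 0 := by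
    rcases h with h | h <;> simp [pow_succ _ 2, h]
  have h1 := qbr_one_ne_zero
  rw [Rmatrix]
  congr 1
  simp only [Finset.sum_range_succ, Finset.sum_range_zero, h2, h3, smul_zero, add_zero, zero_add,
    qfact, Finset.prod_range_succ, Finset.prod_range_zero]
  simp [qpow_zero]
  congr 1
  field_simp

theorem Kinv_mul_K (M : WeightModule ι) : M.Kinv * M.K = 1 := by
  rw [Kinv, K, Matrix.diagonal_mul_diagonal, ← Matrix.diagonal_one]
  congr 1; ext i; rw [← qpow_add]; simp [qpow_zero]

theorem D_E_left (M : WeightModule ι) (N : WeightModule κ) :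
    (M.E ⊗ₖ (1 : Matrix κ κ ℂ)) * Matrix.diagonal (fun p => qpow (M.wt p.1 * N.wt p.2 / 2))
      = Matrix.diagonal (fun p => qpow (M.wt p.1 * N.wt p.2 / 2)) * (M.E ⊗ₖ N.Kinv) := by
  ext ⟨i, k⟩ ⟨j, l⟩
  simp only [Matrix.diagonal_mul, Matrix.mul_diagonal, Matrix.kroneckerMap_apply, Kinv,
    Matrix.diagonal_apply, Matrix.one_apply]
  by_cases h : M.E i j = 0
  · simp [h]
  by_cases hk : k = l
  · subst hk
    rw [M.wt_of_E h]
    simp only [if_true]; push_cast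
    rw [show ((M.wt j : ℂ) + 2) * N.wt k / 2 = M.wt j * N.wt k / 2 + N.wt k by ring, qpow_add,
      qpow_neg]
    field_simp [qpow_ne_zero]
  · simp [hk]

theorem D_E_right (M : WeightModule ι) (N : WeightModule κ) :
    (M.K ⊗ₖ N.E) * Matrix.diagonal (fun p => qpow (M.wt p.1 * N.wt p.2 / 2))
      = Matrix.diagonal (fun p => qpow (M.wt p.1 * N.wt p.2 / 2)) *
        ((1 : Matrix ι ι ℂ) ⊗ₖ N.E) := by
  ext ⟨i, k⟩ ⟨j, l⟩
  simp only [Matrix.diagonal_mul, Matrix.mul_diagonal, Matrix.kroneckerMap_apply, K,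
    Matrix.diagonal_apply, Matrix.one_apply]
  by_cases h : N.E k l = 0
  · simp [h]
  by_cases hk : i = j
  · subst hk
    rw [N.wt_of_E h]
    simp only [if_true]; push_cast
    rw [show (M.wt i : ℂ) * (N.wt l + 2) / 2 = M.wt i * N.wt l / 2 + M.wt i by ring, qpow_add]
    ring
  · simp [hk]

theorem D_F_left (M : WeightModule ι) (N : WeightModule κ) :
    (M.F ⊗ₖ N.Kinv) * Matrix.diagonal (fun p => qpow (M.wt p.1 * N.wt p.2 / 2))
      = Matrix.diagonal (fun p => qpow (M.wt p.1 * N.wt p.2 / 2)) *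
        (M.F ⊗ₖ (1 : Matrix κ κ ℂ)) := by
  ext ⟨i, k⟩ ⟨j, l⟩
  simp only [Matrix.diagonal_mul, Matrix.mul_diagonal, Matrix.kroneckerMap_apply, Kinv,
    Matrix.diagonal_apply, Matrix.one_apply]
  by_cases h : M.F i j = 0
  · simp [h]
  by_cases hk : k = l
  · subst hk
    rw [M.wt_of_F h]
    simp only [if_true]; push_cast
    rw [show ((M.wt j : ℂ) - 2) * N.wt k / 2 = M.wt j * N.wt k / 2 + -N.wt k by ring, qpow_add]
    ring
  · simp [hk]

theorem D_F_right (M : WeightModule ι) (N : WeightModule κ) :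
    ((1 : Matrix ι ι ℂ) ⊗ₖ N.F) * Matrix.diagonal (fun p => qpow (M.wt p.1 * N.wt p.2 / 2))
      = Matrix.diagonal (fun p => qpow (M.wt p.1 * N.wt p.2 / 2)) * (M.K ⊗ₖ N.F) := by
  ext ⟨i, k⟩ ⟨j, l⟩
  simp only [Matrix.diagonal_mul, Matrix.mul_diagonal, Matrix.kroneckerMap_apply, K,
    Matrix.diagonal_apply, Matrix.one_apply]
  by_cases h : N.F k l = 0
  · simp [h]
  by_cases hk : i = j
  · subst hk
    rw [N.wt_of_F h]
    simp only [if_true]; push_cast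
    rw [show (M.wt i : ℂ) * (N.wt l - 2) / 2 = M.wt i * N.wt l / 2 + -M.wt i by ring, qpow_add,
      qpow_neg]
    field_simp [qpow_ne_zero]
  · simp [hk]

theorem commEF (M : WeightModule ι) : qbr 1 • (M.E * M.F - M.F * M.E) = M.K - M.Kinv := by
  rw [M.comm, smul_smul, mul_inv_cancel₀ qbr_one_ne_zero, one_smul]; rfl

/-- The braiding commutes with the action when the `R`-matrix stops after two terms, which is
the case as soon as one of the two factors is `S₁`. -/
theorem braiding_mem (M : WeightModule ι) (N : WeightModule κ)
    (h1 : M.E ^ 2 = 0 ∨ N.F ^ 2 = 0) (h2 : M.E ^ 2 = 0 ∨ N.F * N.K = N.Kinv * N.F)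
    (h3 : N.F ^ 2 = 0 ∨ M.K * M.E = M.E * M.Kinv) :
    braiding M N ∈ Hom (M.tensor N) (N.tensor M) := by
  have hR := Rmatrix_eq M N h1
  have g2 : (M.E ^ 2) ⊗ₖ (N.F * N.K) = (M.E ^ 2) ⊗ₖ (N.Kinv * N.F) := by
    rcases h2 with h | h <;> simp [h]
  have g3 : (M.K * M.E) ⊗ₖ (N.F ^ 2) = (M.E * M.Kinv) ⊗ₖ (N.F ^ 2) := by
    rcases h3 with h | h <;> simp [h]
  have cM := M.commEF
  have cN := N.commEF
  have key : ∀ (X : Matrix (ι × κ) (ι × κ) ℂ) (Y : Matrix (κ × ι) (κ × ι) ℂ)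
      (Z : Matrix (ι × κ) (ι × κ) ℂ), Y * flip ι κ = flip ι κ * Z →
      Z * Rmatrix M N = Rmatrix M N * X → Y * braiding M N = braiding M N * X := by
    intro X Y Z hY hZ
    rw [braiding, ← Matrix.mul_assoc, hY, Matrix.mul_assoc, hZ, Matrix.mul_assoc]
  refine ⟨?_, ?_, ?_⟩
  · refine key _ _ (M.E ⊗ₖ 1 + M.K ⊗ₖ N.E) ?_ ?_
    · change (1 ⊗ₖ M.E + N.E ⊗ₖ M.K) * _ = _
      rw [Matrix.mul_add, flip_mul, flip_mul, Matrix.add_mul]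
    · change _ = _ * (1 ⊗ₖ N.E + M.E ⊗ₖ N.K)
      rw [hR, ← mul_assoc, add_mul, D_E_left, D_E_right, ← mul_add, mul_assoc, mul_assoc]
      congr 1
      simp only [add_mul, mul_add, smul_mul_assoc, mul_smul_comm, ← Matrix.mul_kronecker_mul,
        one_mul, mul_one, ← sq, g2]
      have e1 : qbr 1 • (M.E ⊗ₖ (N.E * N.F)) - qbr 1 • (M.E ⊗ₖ (N.F * N.E))
          = M.E ⊗ₖ N.K - M.E ⊗ₖ N.Kinv := by
        rw [← smul_sub]
        have e2 : M.E ⊗ₖ N.K - M.E ⊗ₖ N.Kinv = M.E ⊗ₖ (N.K - N.Kinv) := by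
          ext p r; simp [mul_sub]
        rw [e2, ← cN]
        ext p r; simp; ring
      rw [← sub_eq_zero] at e1 ⊢
      rw [← e1]
      module
  · refine key _ _ (M.F ⊗ₖ N.Kinv + 1 ⊗ₖ N.F) ?_ ?_
    · change (N.Kinv ⊗ₖ M.F + N.F ⊗ₖ 1) * _ = _
      rw [Matrix.mul_add, flip_mul, flip_mul, Matrix.add_mul]
    · change _ = _ * (M.Kinv ⊗ₖ N.F + M.F ⊗ₖ 1)
      rw [hR, ← mul_assoc, add_mul, D_F_left, D_F_right, ← mul_add, mul_assoc, mul_assoc]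
      congr 1
      simp only [add_mul, mul_add, smul_mul_assoc, mul_smul_comm, ← Matrix.mul_kronecker_mul,
        one_mul, mul_one, ← sq, g3]
      have e1 : qbr 1 • ((M.E * M.F) ⊗ₖ N.F) - qbr 1 • ((M.F * M.E) ⊗ₖ N.F)
          = M.K ⊗ₖ N.F - M.Kinv ⊗ₖ N.F := by
        rw [← smul_sub]
        have e2 : M.K ⊗ₖ N.F - M.Kinv ⊗ₖ N.F = (M.K - M.Kinv) ⊗ₖ N.F := by
          ext p r; simp [sub_mul]
        rw [e2, ← cM]
        ext p r; simp; ring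
      rw [← sub_eq_zero] at e1 ⊢
      rw [← neg_eq_zero, ← e1]
      module
  · ext ⟨k, i⟩ ⟨j, l⟩
    have hfl : ∀ X : Matrix (ι × κ) (ι × κ) ℂ, (flip ι κ * X) (k, i) (j, l) = X (i, k) (j, l) := by
      intro X
      simp [flip, Matrix.mul_apply, Fintype.sum_prod_type, ite_and]
    simp only [H, tensor, Matrix.diagonal_mul, Matrix.mul_diagonal, braiding, hfl, hR,
      Matrix.add_apply, Matrix.smul_apply, Matrix.kroneckerMap_apply, Matrix.one_apply,
      Prod.mk.injEq, smul_eq_mul]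
    by_cases hE : M.E i j = 0
    · by_cases hh : i = j ∧ k = l
      · obtain ⟨rfl, rfl⟩ := hh; simp [hE]; ring
      · simp [hE, hh]
    · by_cases hF : N.F k l = 0
      · by_cases hh : i = j ∧ k = l
        · obtain ⟨rfl, rfl⟩ := hh; simp [hF]; ring
        · simp [hF, hh]
      · have a := M.wt_of_E hE
        have b := N.wt_of_F hF
        have : N.wt k + M.wt i = M.wt j + N.wt l := by linarith
        rw [this]; ring

end WeightModule

theorem S1_E_sq : S1.E ^ 2 = 0 := by
  ext i j; fin_cases i <;> fin_cases j <;> simp [S1, sq, Matrix.mul_apply]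

theorem S1_F_sq : S1.F ^ 2 = 0 := by
  ext i j; fin_cases i <;> fin_cases j <;> simp [S1, sq, Matrix.mul_apply]

theorem S1_KE : S1.K * S1.E = S1.E * S1.Kinv := by
  ext i j; fin_cases i <;> fin_cases j <;> simp [S1, K, Kinv]

theorem S1_FK : S1.F * S1.K = S1.Kinv * S1.F := by
  ext i j; fin_cases i <;> fin_cases j <;> simp [S1, K, Kinv]

theorem braiding_S1_right {ι : Type} [Fintype ι] [DecidableEq ι] (M : WeightModule ι) :
    braiding M S1 ∈ Hom (M.tensor S1) (S1.tensor M) :=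
  braiding_mem M S1 (Or.inr S1_F_sq) (Or.inr S1_FK) (Or.inl S1_F_sq)

theorem braiding_S1_left {ι : Type} [Fintype ι] [DecidableEq ι] (M : WeightModule ι) :
    braiding S1 M ∈ Hom (S1.tensor M) (M.tensor S1) :=
  braiding_mem S1 M (Or.inl S1_E_sq) (Or.inl S1_E_sq) (Or.inr S1_KE)

/-! ### Trivalent vertices -/

/-- The linear map `V_β → N` with `vᵢ ↦ Fⁱ v`. -/
def lift {κ : Type} [Fintype κ] [DecidableEq κ] (N : WeightModule κ) (v : κ → ℂ) :
    Matrix κ (Fin 4) ℂ :=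
  Matrix.of fun p i => ((N.F ^ (i : ℕ)) *ᵥ v) p

theorem F_pow_wt {κ : Type} [Fintype κ] [DecidableEq κ] (N : WeightModule κ) {v : κ → ℂ} {c : ℂ}
    (hH : ∀ p, ((N.wt p : ℂ) - c) * v p = 0) (i : ℕ) (p : κ) :
    ((N.wt p : ℂ) - (c - 2 * i)) * ((N.F ^ i) *ᵥ v) p = 0 := by
  induction i generalizing p with
  | zero => simpa using hH p
  | succ i ih =>
    rw [pow_succ', ← Matrix.mulVec_mulVec, Matrix.mulVec, dotProduct, Finset.mul_sum]
    refine Finset.sum_eq_zero fun j _ => ?_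
    by_cases h : N.F p j = 0
    · simp [h]
    · have h1 := N.wt_of_F h
      have h2 : ((N.wt p : ℂ) - (c - 2 * ((i + 1 : ℕ) : ℂ))) = (N.wt j : ℂ) - (c - 2 * i) := by
        rw [h1]; push_cast; ring
      rw [h2, mul_left_comm, ih j, mul_zero]

theorem K_sub_apply {κ : Type} [Fintype κ] [DecidableEq κ] (N : WeightModule κ) {v : κ → ℂ}
    {c : ℂ} (hH : ∀ p, ((N.wt p : ℂ) - c) * v p = 0) :
    (N.K - N.Kinv) *ᵥ v = (qpow c - qpow (-c)) • v := by
  ext p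
  simp only [K, Kinv, Matrix.sub_mulVec, Pi.sub_apply, Matrix.mulVec_diagonal, Pi.smul_apply,
    smul_eq_mul]
  rcases mul_eq_zero.1 (hH p) with h | h
  · rw [sub_eq_zero.1 h]; ring
  · simp [h]

theorem E_F_pow {κ : Type} [Fintype κ] [DecidableEq κ] (N : WeightModule κ) {v : κ → ℂ} {β : ℝ}
    (hE : N.E *ᵥ v = 0) (hH : ∀ p, ((N.wt p : ℂ) - (β + 3)) * v p = 0) (i : ℕ) :
    N.E *ᵥ ((N.F ^ (i + 1)) *ᵥ v) =
      (qnum ((i + 1 : ℕ) : ℂ) * qnum (((i + 1 : ℕ) : ℂ) - β)) • ((N.F ^ i) *ᵥ v) := by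
  have step : ∀ j : ℕ, N.E *ᵥ ((N.F ^ (j + 1)) *ᵥ v) = N.F *ᵥ (N.E *ᵥ ((N.F ^ j) *ᵥ v)) +
      ((qbr 1)⁻¹ * (qpow (β + 3 - 2 * j) - qpow (-(β + 3 - 2 * j)))) • ((N.F ^ j) *ᵥ v) := by
    intro j
    have hc : N.E * N.F = N.F * N.E + (qbr 1)⁻¹ • (N.K - N.Kinv) := by
      have := N.comm
      rw [← sub_eq_iff_eq_add']
      exact this
    rw [pow_succ', ← Matrix.mulVec_mulVec, Matrix.mulVec_mulVec _ N.E, hc, Matrix.add_mulVec,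
      Matrix.smul_mulVec, K_sub_apply N (F_pow_wt N hH j), smul_smul, ← Matrix.mulVec_mulVec]
  induction i with
  | zero =>
    rw [step 0]
    have h0 := qnum_shift β 0
    rw [qnum_zero, zero_mul, sub_zero, zero_add] at h0
    simp only [pow_zero, Matrix.one_mulVec, hE, Matrix.mulVec_zero, zero_add, Nat.cast_zero,
      Nat.cast_one]
    rw [h0]
  | succ i ih =>
    rw [step (i + 1), ih, Matrix.mulVec_smul, Matrix.mulVec_mulVec, ← pow_succ', ← add_smul]
    congr 1
    have h0 := qnum_shift β ((i + 1 : ℕ) : ℂ)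
    rw [← h0]
    push_cast
    ring

/-- A highest weight vector of weight `β + 3` in `N` gives an element of `Hom(V_β, N)`. -/
theorem lift_mem {κ : Type} [Fintype κ] [DecidableEq κ] (N : WeightModule κ) {v : κ → ℂ} {β : ℝ}
    (hE : N.E *ᵥ v = 0) (hH : ∀ p, ((N.wt p : ℂ) - (β + 3)) * v p = 0) :
    lift N v ∈ Hom (V β) N := by
  have hEF := E_F_pow N hE hH
  refine ⟨?_, ?_, ?_⟩
  · ext p i
    have h1 : (N.E * lift N v) p i = (N.E *ᵥ ((N.F ^ (i : ℕ)) *ᵥ v)) p := rfl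
    rw [h1]
    fin_cases i
    · simp [hE, Matrix.mul_apply, V, lift]
    · have h2 := congrFun (hEF 0) p
      simp only [zero_add, pow_one, Matrix.mulVec_mulVec] at h2
      simp [h2, Matrix.mul_apply, V, lift, mul_comm]
    · simp [hEF 1, Matrix.mul_apply, V, lift, Fin.sum_univ_four, mul_comm]
    · simp [hEF 2, Matrix.mul_apply, V, lift, Fin.sum_univ_four, mul_comm]
  · ext p i
    have h1 : (N.F * lift N v) p i = (N.F *ᵥ ((N.F ^ (i : ℕ)) *ᵥ v)) p := rfl
    rw [h1, Matrix.mulVec_mulVec, ← pow_succ']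
    fin_cases i
    · simp [Matrix.mul_apply, V, lift, Fin.sum_univ_four]
    · simp [Matrix.mul_apply, V, lift, Fin.sum_univ_four]
    · simp [Matrix.mul_apply, V, lift, Fin.sum_univ_four]
    · simp [N.F_nil, Matrix.mul_apply, V, lift, Fin.sum_univ_four]
  · ext p i
    have h1 := F_pow_wt N hH i p
    simp only [H, Matrix.diagonal_mul, Matrix.mul_diagonal, lift, Matrix.of_apply, V]
    push_cast
    linear_combination h1

/-- `Y^{β1}_{β+1} : V_{β+1} → V_β ⊗ S₁`, `v₀ ↦ v₀ ⊗ s₀`. -/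
def Yplus (β : ℝ) : Matrix (Fin 4 × Fin 2) (Fin 4) ℂ :=
  lift ((V β).tensor S1) (Pi.single (0, 0) 1)

/-- `Y^{β1}_{β-1} : V_{β-1} → V_β ⊗ S₁`, `v₀ ↦ v₀ ⊗ s₁ - (q [1 - β])⁻¹ v₁ ⊗ s₀`. -/
def Yminus (β : ℝ) : Matrix (Fin 4 × Fin 2) (Fin 4) ℂ :=
  lift ((V β).tensor S1) (Pi.single (0, 1) 1 - (qpow 1 * qnum (1 - β))⁻¹ • Pi.single (1, 0) 1)

/-- `Y^{1β}_{β+1} : V_{β+1} → S₁ ⊗ V_β`, `v₀ ↦ s₀ ⊗ v₀`. -/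
def Yplus' (β : ℝ) : Matrix (Fin 2 × Fin 4) (Fin 4) ℂ :=
  lift (S1.tensor (V β)) (Pi.single (0, 0) 1)

/-- `Y^{1β}_{β-1} : V_{β-1} → S₁ ⊗ V_β`, `v₀ ↦ s₀ ⊗ v₁ - [1 - β] q^{-β-3} s₁ ⊗ v₀`. -/
def Yminus' (β : ℝ) : Matrix (Fin 2 × Fin 4) (Fin 4) ℂ :=
  lift (S1.tensor (V β))
    (Pi.single (0, 1) 1 - (qnum (1 - β) * qpow (-β - 3)) • Pi.single (1, 0) 1)

theorem Yplus_mem {β γ : ℝ} (h : γ = β + 1) : Yplus β ∈ Hom (V γ) ((V β).tensor S1) := by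
  subst h
  refine lift_mem _ ?_ ?_
  · ext ⟨i, j⟩
    simp [tensor, V, S1, Matrix.one_apply]
  · rintro ⟨i, j⟩
    fin_cases i <;> fin_cases j <;> simp [tensor, V, S1] <;> ring

theorem Yplus'_mem {β γ : ℝ} (h : γ = β + 1) : Yplus' β ∈ Hom (V γ) (S1.tensor (V β)) := by
  subst h
  refine lift_mem _ ?_ ?_
  · ext ⟨i, j⟩
    simp [tensor, V, S1, Matrix.one_apply]
  · rintro ⟨i, j⟩
    fin_cases i <;> fin_cases j <;> simp [tensor, V, S1] <;> ring

theorem qnum_ne_zero {x : ℝ} (hx : ∀ n : ℤ, x ≠ n) : qnum x ≠ 0 :=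
  div_ne_zero (qbr_ne_zero hx) qbr_one_ne_zero

theorem qnum_one_sub_ne_zero {x : ℝ} (hx : ∀ n : ℤ, x ≠ n) : qnum (1 - x) ≠ 0 := by
  have h := qnum_ne_zero (x := 1 - x) (fun n hn => hx (1 - n) (by push_cast; linarith))
  push_cast at h
  exact h

theorem Yminus_mem {β γ : ℝ} (hβ : ∀ n : ℤ, β ≠ n) (h : γ = β - 1) :
    Yminus β ∈ Hom (V γ) ((V β).tensor S1) := by
  subst h
  have h1 := qnum_one_sub_ne_zero hβ
  have h2 := qpow_ne_zero 1
  refine lift_mem _ ?_ ?_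
  · ext ⟨i, j⟩
    fin_cases i <;> fin_cases j <;>
      simp [Matrix.mulVec_sub, Matrix.mulVec_smul, tensor, V, S1, K, qnum_one]
    field_simp
    simp
  · rintro ⟨i, j⟩
    fin_cases i <;> fin_cases j <;> simp [tensor, V, S1] <;> ring_nf <;> simp

theorem Yminus'_mem {β γ : ℝ} (h : γ = β - 1) : Yminus' β ∈ Hom (V γ) (S1.tensor (V β)) := by
  subst h
  refine lift_mem _ ?_ ?_
  · ext ⟨i, j⟩
    fin_cases i <;> fin_cases j <;>
      simp [Matrix.mulVec_sub, Matrix.mulVec_smul, tensor, V, S1, K, qnum_one]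
    rw [mul_assoc, ← qpow_add]
    ring_nf
    simp [qpow_zero]
  · rintro ⟨i, j⟩
    fin_cases i <;> fin_cases j <;> simp [tensor, V, S1] <;> ring_nf <;> simp

/-! ### The one-qubit space -/

/-- `(V_α ⊗ S₁) ⊗ S₁`. -/
def V11 (α : ℝ) : WeightModule ((Fin 4 × Fin 2) × Fin 2) := ((V α).tensor S1).tensor S1

/-- The one-qubit space `Hom(α, α ⊗ 1 ⊗ 1)`. -/
def H1 (α : ℝ) : Submodule ℂ (Matrix ((Fin 4 × Fin 2) × Fin 2) (Fin 4) ℂ) := Hom (V α) (V11 α)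

namespace WeightModule

variable {ι κ ν : Type} [Fintype ι] [DecidableEq ι] [Fintype κ] [DecidableEq κ]
  [Fintype ν] [DecidableEq ν]

theorem Hom_comp {M : WeightModule ι} {N : WeightModule κ} {P : WeightModule ν}
    {g : Matrix ν κ ℂ} {f : Matrix κ ι ℂ} (hg : g ∈ Hom N P) (hf : f ∈ Hom M N) :
    g * f ∈ Hom M P := by
  obtain ⟨a1, a2, a3⟩ := hg
  obtain ⟨b1, b2, b3⟩ := hf
  refine ⟨?_, ?_, ?_⟩
  · rw [← Matrix.mul_assoc, a1, Matrix.mul_assoc, b1, Matrix.mul_assoc]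
  · rw [← Matrix.mul_assoc, a2, Matrix.mul_assoc, b2, Matrix.mul_assoc]
  · rw [← Matrix.mul_assoc, a3, Matrix.mul_assoc, b3, Matrix.mul_assoc]

theorem Hom_wt {M : WeightModule ι} {N : WeightModule κ} {f : Matrix κ ι ℂ} (hf : f ∈ Hom M N)
    {k : κ} {i : ι} (h : f k i ≠ 0) : N.wt k = M.wt i := by
  have h1 := congrFun (congrFun hf.2.2 k) i
  simp only [H, Matrix.diagonal_mul, Matrix.mul_diagonal] at h1
  have h2 : ((N.wt k : ℂ) - M.wt i) * f k i = 0 := by linear_combination h1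
  exact_mod_cast sub_eq_zero.1 ((mul_eq_zero.1 h2).resolve_right h)

theorem Hom_tensor_one {M : WeightModule ι} {N : WeightModule κ} (P : WeightModule ν)
    {f : Matrix κ ι ℂ} (hf : f ∈ Hom M N) :
    f ⊗ₖ (1 : Matrix ν ν ℂ) ∈ Hom (M.tensor P) (N.tensor P) := by
  obtain ⟨a1, a2, a3⟩ := id hf
  have hK : N.Kinv * f = f * M.Kinv := by
    ext k i
    simp only [Kinv, Matrix.diagonal_mul, Matrix.mul_diagonal]
    by_cases h : f k i = 0
    · simp [h]
    · rw [Hom_wt hf h]; ring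
  refine ⟨?_, ?_, ?_⟩
  · change (1 ⊗ₖ P.E + N.E ⊗ₖ P.K) * _ = _ * (1 ⊗ₖ P.E + M.E ⊗ₖ P.K)
    rw [Matrix.add_mul, Matrix.mul_add]
    simp only [← Matrix.mul_kronecker_mul, Matrix.one_mul, Matrix.mul_one, a1]
  · change (N.Kinv ⊗ₖ P.F + N.F ⊗ₖ 1) * _ = _ * (M.Kinv ⊗ₖ P.F + M.F ⊗ₖ 1)
    rw [Matrix.add_mul, Matrix.mul_add]
    simp only [← Matrix.mul_kronecker_mul, Matrix.one_mul, Matrix.mul_one, a2, hK]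
  · ext ⟨k, l⟩ ⟨i, j⟩
    simp only [H, tensor, Matrix.diagonal_mul, Matrix.mul_diagonal, Matrix.kroneckerMap_apply,
      Matrix.one_apply]
    by_cases h : f k i = 0
    · simp [h]
    · by_cases hl : l = j
      · subst hl; rw [Hom_wt hf h]; ring
      · simp [hl]

theorem Hom_one_tensor {M : WeightModule ι} {N : WeightModule κ} (P : WeightModule ν)
    {f : Matrix κ ι ℂ} (hf : f ∈ Hom M N) :
    (1 : Matrix ν ν ℂ) ⊗ₖ f ∈ Hom (P.tensor M) (P.tensor N) := by
  obtain ⟨a1, a2, a3⟩ := id hf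
  have hK : N.K * f = f * M.K := by
    ext k i
    simp only [K, Matrix.diagonal_mul, Matrix.mul_diagonal]
    by_cases h : f k i = 0
    · simp [h]
    · rw [Hom_wt hf h]; ring
  refine ⟨?_, ?_, ?_⟩
  · change (1 ⊗ₖ N.E + P.E ⊗ₖ N.K) * _ = _ * (1 ⊗ₖ M.E + P.E ⊗ₖ M.K)
    rw [Matrix.add_mul, Matrix.mul_add]
    simp only [← Matrix.mul_kronecker_mul, Matrix.one_mul, Matrix.mul_one, a1, hK]
  · change (P.Kinv ⊗ₖ N.F + P.F ⊗ₖ 1) * _ = _ * (P.Kinv ⊗ₖ M.F + P.F ⊗ₖ 1)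
    rw [Matrix.add_mul, Matrix.mul_add]
    simp only [← Matrix.mul_kronecker_mul, Matrix.one_mul, Matrix.mul_one, a2]
  · ext ⟨l, k⟩ ⟨j, i⟩
    simp only [H, tensor, Matrix.diagonal_mul, Matrix.mul_diagonal, Matrix.kroneckerMap_apply,
      Matrix.one_apply]
    by_cases h : f k i = 0
    · simp [h]
    · by_cases hl : l = j
      · subst hl; rw [Hom_wt hf h]; ring
      · simp [hl]

/-- The associator carries an endomorphism of `M ⊗ (N ⊗ P)` to one of `(M ⊗ N) ⊗ P`. -/
theorem Hom_assoc (M : WeightModule ι) (N : WeightModule κ) (P : WeightModule ν)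
    {f : Matrix (ι × κ × ν) (ι × κ × ν) ℂ}
    (hf : f ∈ Hom (M.tensor (N.tensor P)) (M.tensor (N.tensor P))) :
    f.submatrix (Equiv.prodAssoc ι κ ν) (Equiv.prodAssoc ι κ ν) ∈
      Hom ((M.tensor N).tensor P) ((M.tensor N).tensor P) := by
  obtain ⟨a1, a2, a3⟩ := hf
  have e1 : ((M.tensor N).tensor P).E = ((M.tensor (N.tensor P)).E).submatrix
      (Equiv.prodAssoc ι κ ν) (Equiv.prodAssoc ι κ ν) := by
    ext ⟨⟨i, k⟩, n⟩ ⟨⟨j, l⟩, m⟩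
    simp only [tensor, K, Matrix.add_apply, Matrix.kroneckerMap_apply, Matrix.one_apply,
      Matrix.submatrix_apply, Equiv.prodAssoc_apply, Matrix.diagonal_apply, Prod.mk.injEq]
    by_cases h1 : i = j <;> by_cases h2 : k = l <;> by_cases h3 : n = m <;>
      simp [h1, h2, h3, qpow_add] <;> ring
  have e2 : ((M.tensor N).tensor P).F = ((M.tensor (N.tensor P)).F).submatrix
      (Equiv.prodAssoc ι κ ν) (Equiv.prodAssoc ι κ ν) := by
    ext ⟨⟨i, k⟩, n⟩ ⟨⟨j, l⟩, m⟩
    simp only [tensor, Kinv, Matrix.add_apply, Matrix.kroneckerMap_apply, Matrix.one_apply,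
      Matrix.submatrix_apply, Equiv.prodAssoc_apply, Matrix.diagonal_apply, Prod.mk.injEq]
    by_cases h1 : i = j <;> by_cases h2 : k = l <;> by_cases h3 : n = m <;>
      simp [h1, h2, h3, qpow_add] <;> ring
  have e3 : ((M.tensor N).tensor P).H = ((M.tensor (N.tensor P)).H).submatrix
      (Equiv.prodAssoc ι κ ν) (Equiv.prodAssoc ι κ ν) := by
    ext ⟨⟨i, k⟩, n⟩ ⟨⟨j, l⟩, m⟩
    simp only [tensor, H, Matrix.submatrix_apply, Equiv.prodAssoc_apply, Matrix.diagonal_apply,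
      Prod.mk.injEq, and_assoc, add_assoc]
  refine ⟨?_, ?_, ?_⟩
  · rw [e1, Matrix.submatrix_mul_equiv, Matrix.submatrix_mul_equiv, a1]
  · rw [e2, Matrix.submatrix_mul_equiv, Matrix.submatrix_mul_equiv, a2]
  · rw [e3, Matrix.submatrix_mul_equiv, Matrix.submatrix_mul_equiv, a3]

/-- Post-composition with an endomorphism of `N`, as a linear operator on `Hom(M, N)`. -/
def postcomp (M : WeightModule ι) {N : WeightModule κ} {g : Matrix κ κ ℂ} (hg : g ∈ Hom N N) :
    Hom M N →ₗ[ℂ] Hom M N where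
  toFun f := ⟨g * f.1, Hom_comp hg f.2⟩
  map_add' _ _ := Subtype.ext (Matrix.mul_add _ _ _)
  map_smul' _ _ := Subtype.ext (Matrix.mul_smul _ _ _)

end WeightModule

/-- The braid `b₁²` of `α ⊗ 1 ⊗ 1`: the first Ising anyon winds once around `α`. -/
def b1sq (α : ℝ) : Matrix ((Fin 4 × Fin 2) × Fin 2) ((Fin 4 × Fin 2) × Fin 2) ℂ :=
  (braiding S1 (V α) * braiding (V α) S1) ⊗ₖ 1

/-- The braid `b₂` of `α ⊗ 1 ⊗ 1`: the two Ising anyons are exchanged. -/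
def b2 : Matrix ((Fin 4 × Fin 2) × Fin 2) ((Fin 4 × Fin 2) × Fin 2) ℂ :=
  ((1 : Matrix (Fin 4) (Fin 4) ℂ) ⊗ₖ braiding S1 S1).submatrix
    (Equiv.prodAssoc (Fin 4) (Fin 2) (Fin 2)) (Equiv.prodAssoc (Fin 4) (Fin 2) (Fin 2))

theorem b1sq_mem (α : ℝ) : b1sq α ∈ Hom (V11 α) (V11 α) :=
  Hom_tensor_one S1 (Hom_comp (braiding_S1_left _) (braiding_S1_right _))

theorem b2_mem (α : ℝ) : b2 ∈ Hom (V11 α) (V11 α) :=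
  Hom_assoc _ _ _ (Hom_one_tensor (V α) (braiding_S1_right S1))

/-- The action of `J₁ = b₁²` on the one-qubit space. -/
def J1op (α : ℝ) : H1 α →ₗ[ℂ] H1 α := postcomp (V α) (b1sq_mem α)

/-- The action of `b₂` on the one-qubit space. -/
def b2op (α : ℝ) : H1 α →ₗ[ℂ] H1 α := postcomp (V α) (b2_mem α)

theorem add_int_ne {α : ℝ} (hα : ∀ n : ℤ, α ≠ n) (m : ℤ) (n : ℤ) : α + m ≠ n := by
  intro h
  exact hα (n - m) (by push_cast; linarith)

/-- The fusion trees `|0⟩ = ((α, 1)_{α+1}, 1)_α` and `|1⟩ = ((α, 1)_{α-1}, 1)_α`, as linear maps. -/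
def ketMat (α : ℝ) : Fin 2 → Matrix ((Fin 4 × Fin 2) × Fin 2) (Fin 4) ℂ :=
  ![(Yplus α ⊗ₖ (1 : Matrix (Fin 2) (Fin 2) ℂ)) * Yminus (α + 1),
    (Yminus α ⊗ₖ (1 : Matrix (Fin 2) (Fin 2) ℂ)) * Yplus (α - 1)]

theorem ketMat_mem {α : ℝ} (hα : ∀ n : ℤ, α ≠ n) (i : Fin 2) : ketMat α i ∈ H1 α := by
  fin_cases i
  · have h : ∀ n : ℤ, α + 1 ≠ n := by
      intro n; have := add_int_ne hα 1 n; push_cast at this; exact this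
    exact Hom_comp (Hom_tensor_one S1 (Yplus_mem rfl)) (Yminus_mem h (by ring))
  · exact Hom_comp (Hom_tensor_one S1 (Yminus_mem hα rfl)) (Yplus_mem (by ring))

/-- The basis vectors `|0⟩` and `|1⟩` of the one-qubit space. -/
def ket {α : ℝ} (hα : ∀ n : ℤ, α ≠ n) (i : Fin 2) : H1 α := ⟨ketMat α i, ketMat_mem hα i⟩

theorem ket_zero_fst (α : ℝ) : ketMat α 0 ((0, 0), 1) 0 = 1 := by
  simp [ketMat, Matrix.mul_apply, Fintype.sum_prod_type, Fin.sum_univ_four, Yplus, Yminus, lift,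
    tensor, V, S1, Matrix.one_apply, Kinv]

theorem ket_one_fst (α : ℝ) : ketMat α 1 ((0, 0), 1) 0 = 0 := by
  simp [ketMat, Matrix.mul_apply, Fintype.sum_prod_type, Fin.sum_univ_four, Yplus, Yminus, lift,
    tensor, V, S1, Matrix.one_apply, Kinv]

theorem ket_one_snd (α : ℝ) : ketMat α 1 ((0, 1), 0) 0 = 1 := by
  simp [ketMat, Matrix.mul_apply, Fintype.sum_prod_type, Fin.sum_univ_four, Yplus, Yminus, lift,
    tensor, V, S1, Matrix.one_apply, Kinv]

theorem H1_eq_zero {α : ℝ} (hα : ∀ n : ℤ, α ≠ n) {f : Matrix ((Fin 4 × Fin 2) × Fin 2) (Fin 4) ℂ}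
    (hf : f ∈ H1 α) (h0 : f ((0, 0), 1) 0 = 0) (h1 : f ((0, 1), 0) 0 = 0) : f = 0 := by
  have hq := qnum_one_sub_ne_zero hα
  have hq1 := qpow_ne_zero 1
  have hE := congrFun (congrFun hf.1 ((0, 0), 0)) 0
  have h2 : f ((1, 0), 0) 0 = 0 := by
    simp [Matrix.mul_apply, Fintype.sum_prod_type, Fin.sum_univ_four, V11,
      tensor, V, S1, Matrix.one_apply, K, h0, h1, qnum_one] at hE
    tauto
  have hw : ∀ p, f p 0 ≠ 0 → (V11 α).wt p = α + 3 := by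
    intro p hp
    rw [Hom_wt hf hp]; simp [V]
  have hc0 : ∀ p, f p 0 = 0 := by
    rintro ⟨⟨i, j⟩, k⟩
    by_contra hp
    have := hw _ hp
    fin_cases i <;> fin_cases j <;> fin_cases k <;>
      first
      | exact hp h0
      | exact hp h1
      | exact hp h2
      | (exfalso; simp [V11, tensor, V, S1] at this; done)
      | (exfalso; simp [V11, tensor, V, S1] at this; linarith)
  have hF : ∀ p (i : Fin 4) (j : Fin 4), (i : ℕ) + 1 = j → (∀ r, f r i = 0) → f p j = 0 := by
    intro p i j hij hr
    have h3 := congrFun (congrFun hf.2.1 p) i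
    rw [Matrix.mul_apply, Finset.sum_eq_zero (fun r _ => by rw [hr r, mul_zero])] at h3
    rw [Matrix.mul_apply, Finset.sum_eq_single j] at h3
    · simpa [V, hij] using h3.symm
    · intro l _ hl
      have : ¬ ((i : ℕ) + 1 = (l : ℕ)) := fun h => hl (Fin.ext (by omega))
      simp [V, this]
    · simp
  have hc1 : ∀ p, f p 1 = 0 := fun p => hF p 0 1 rfl hc0
  have hc2 : ∀ p, f p 2 = 0 := fun p => hF p 1 2 rfl hc1
  have hc3 : ∀ p, f p 3 = 0 := fun p => hF p 2 3 rfl hc2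
  ext p i
  fin_cases i
  · exact hc0 p
  · exact hc1 p
  · exact hc2 p
  · exact hc3 p

theorem ket_linearIndependent {α : ℝ} (hα : ∀ n : ℤ, α ≠ n) : LinearIndependent ℂ (ket hα) := by
  rw [Fintype.linearIndependent_iff]
  intro g hg
  have h : g 0 • ketMat α 0 + g 1 • ketMat α 1 = 0 := by
    have := congrArg Subtype.val hg
    simpa [Fin.sum_univ_two, ket] using this
  have e0 := congrFun (congrFun h ((0, 0), 1)) 0
  simp only [Matrix.add_apply, Matrix.smul_apply, ket_zero_fst, ket_one_fst, smul_eq_mul,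
    mul_one, mul_zero, add_zero, Matrix.zero_apply] at e0
  have e1 := congrFun (congrFun h ((0, 1), 0)) 0
  simp only [Matrix.add_apply, Matrix.smul_apply, ket_one_snd, smul_eq_mul, e0, zero_mul,
    mul_one, zero_add, Matrix.zero_apply] at e1
  intro i
  fin_cases i
  · exact e0
  · exact e1

theorem ket_span {α : ℝ} (hα : ∀ n : ℤ, α ≠ n) :
    ⊤ ≤ Submodule.span ℂ (Set.range (ket hα)) := by
  rintro ⟨f, hf⟩ -
  set a := f ((0, 0), 1) 0 with ha
  set b := f ((0, 1), 0) 0 - a * ketMat α 0 ((0, 1), 0) 0 with hb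
  have hmem : f - (a • ketMat α 0 + b • ketMat α 1) ∈ H1 α :=
    (H1 α).sub_mem hf ((H1 α).add_mem ((H1 α).smul_mem _ (ketMat_mem hα 0))
      ((H1 α).smul_mem _ (ketMat_mem hα 1)))
  have hz := H1_eq_zero hα hmem
    (by simp [ket_zero_fst, ket_one_fst, ← ha]) (by simp [ket_one_snd, hb])
  have : (⟨f, hf⟩ : H1 α) = a • ket hα 0 + b • ket hα 1 :=
    Subtype.ext (by simpa [ket] using sub_eq_zero.1 hz)
  rw [this]
  exact add_mem (Submodule.smul_mem _ _ (Submodule.subset_span ⟨0, rfl⟩))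
    (Submodule.smul_mem _ _ (Submodule.subset_span ⟨1, rfl⟩))

/-- The fusion trees `|0⟩`, `|1⟩` as a basis of the one-qubit space. -/
def ketBasis {α : ℝ} (hα : ∀ n : ℤ, α ≠ n) : Module.Basis (Fin 2) ℂ (H1 α) :=
  Module.Basis.mk (ket_linearIndependent hα) (ket_span hα)

/-! ### The Hermitian structure -/

/-- The Gram matrix `diag(1, β₁, β₁ β₂, β₁ β₂ β₃)`, `βₖ = [k] [k - β]`, of the invariant
Hermitian form of `V_β` in the basis `v₀, …, v₃`. -/
def gramV (β : ℝ) : Matrix (Fin 4) (Fin 4) ℂ :=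
  Matrix.diagonal fun i =>
    ∏ k ∈ Finset.range (i : ℕ), (qnum ((k : ℂ) + 1) * qnum ((k : ℂ) + 1 - β))

/-- The Gram matrix of the invariant Hermitian form of `S₁`: the basis `s₀, s₁` is orthonormal. -/
def gramS1 : Matrix (Fin 2) (Fin 2) ℂ := 1

/-- The square root `q ^ ((β² - 9) / 4)` of the twist of `V_β`. -/
def sqrtTwistV (β : ℝ) : ℂ := qpow (((β : ℂ) ^ 2 - 9) / 4)

/-- The square root `q ^ (-5 / 4)` of the twist of `S₁`. -/
def sqrtTwistS1 : ℂ := qpow (-5 / 4)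

/-- The matrix of the decomposition `V_{β+1} ⊕ V_{β-1} → S₁ ⊗ V_β`. The column index `(0, i)`
is `vᵢ ∈ V_{β+1}` and the column index `(1, i)` is `vᵢ ∈ V_{β-1}`. -/
def decomp (β : ℝ) : Matrix (Fin 2 × Fin 4) (Fin 2 × Fin 4) ℂ :=
  Matrix.of fun p r => if r.1 = 0 then Yplus' β p r.2 else Yminus' β p r.2

/-- The square root of the twist on `S₁ ⊗ V_β`: it acts on the summands `V_{β+1}` and `V_{β-1}`
by the square roots of their twists. -/
def sqrtTwistTensor (β : ℝ) : Matrix (Fin 2 × Fin 4) (Fin 2 × Fin 4) ℂ :=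
  decomp β *
    Matrix.diagonal (fun r => if r.1 = 0 then sqrtTwistV (β + 1) else sqrtTwistV (β - 1)) *
    (decomp β)⁻¹

/-- `X = (√θ_{S₁ ⊗ V_β})⁻¹ ∘ c_{V_β, S₁} ∘ (√θ_{V_β} ⊗ √θ_{S₁})`. -/
def Xmap (β : ℝ) : Matrix (Fin 2 × Fin 4) (Fin 4 × Fin 2) ℂ :=
  (sqrtTwistTensor β)⁻¹ * braiding (V β) S1 *
    ((sqrtTwistV β • (1 : Matrix (Fin 4) (Fin 4) ℂ)) ⊗ₖ
      (sqrtTwistS1 • (1 : Matrix (Fin 2) (Fin 2) ℂ)))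

/-- The Gram matrix of the invariant Hermitian form `⟨x, η y⟩` of `V_β ⊗ S₁`, where
`⟨ , ⟩` is the product of the forms of `V_β` and `S₁` and `η = τ X`. -/
def gramTensor (β : ℝ) : Matrix (Fin 4 × Fin 2) (Fin 4 × Fin 2) ℂ :=
  (gramV β ⊗ₖ gramS1) * (flip (Fin 2) (Fin 4) * Xmap β)

/-- The adjoint `(Y^{β1}_{β+1})†` with respect to the forms of `V_{β+1}` and `V_β ⊗ S₁`. -/
def YplusDag (β : ℝ) : Matrix (Fin 4) (Fin 4 × Fin 2) ℂ :=
  (gramV (β + 1))⁻¹ * (Yplus β)ᴴ * gramTensor β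

/-- The adjoint `(Y^{β1}_{β-1})†` with respect to the forms of `V_{β-1}` and `V_β ⊗ S₁`. -/
def YminusDag (β : ℝ) : Matrix (Fin 4) (Fin 4 × Fin 2) ℂ :=
  (gramV (β - 1))⁻¹ * (Yminus β)ᴴ * gramTensor β

/-- The adjoints of the fusion trees `|0⟩` and `|1⟩`: the reflected trees. -/
def bra (α : ℝ) : Fin 2 → Matrix (Fin 4) ((Fin 4 × Fin 2) × Fin 2) ℂ :=
  ![YminusDag (α + 1) * (YplusDag α ⊗ₖ (1 : Matrix (Fin 2) (Fin 2) ℂ)),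
    YplusDag (α - 1) * (YminusDag α ⊗ₖ (1 : Matrix (Fin 2) (Fin 2) ℂ))]

/-- The modified dimension `d_α = - 4 {α} / {4 α}`. -/
def modDim (α : ℝ) : ℂ := -4 * qbr α / qbr (4 * α)

/-- The modified trace on `End(V_α)`: it sends `c • id` to `c * d_α`. -/
def modTrace (α : ℝ) (f : Matrix (Fin 4) (Fin 4) ℂ) : ℂ := modDim α * (f.trace / 4)

/-- The inner product `⟨i|j⟩ = t(|i⟩† |j⟩)`. -/
def braket (α : ℝ) (i j : Fin 2) : ℂ := modTrace α (bra α i * ketMat α j)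

/-- The change to the normalized basis, `diag(√⟨0|0⟩, √⟨1|1⟩)`, with the principal branch of the
complex square root. -/
def normalizer (α : ℝ) : Matrix (Fin 2) (Fin 2) ℂ :=
  Matrix.diagonal fun i => braket α i i ^ (1 / 2 : ℂ)

/-- The matrix of an operator on the one-qubit space in the normalized basis. -/
def normalizedMatrix {α : ℝ} (hα : ∀ n : ℤ, α ≠ n) (T : H1 α →ₗ[ℂ] H1 α) :
    Matrix (Fin 2) (Fin 2) ℂ :=
  normalizer α * LinearMap.toMatrix (ketBasis hα) (ketBasis hα) T * (normalizer α)⁻¹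

/-- The matrix of `J₁ = b₁²` in the normalized basis. -/
def J1norm {α : ℝ} (hα : ∀ n : ℤ, α ≠ n) : Matrix (Fin 2) (Fin 2) ℂ :=
  normalizedMatrix hα (J1op α)

/-- The matrix of `b₂` in the normalized basis. -/
def b2norm {α : ℝ} (hα : ∀ n : ℤ, α ≠ n) : Matrix (Fin 2) (Fin 2) ℂ :=
  normalizedMatrix hα (b2op α)

end

end NonssIsing

/-!
Write `A = -q J₁` and `B = q ^ (-3/2) b₂` in the normalized basis. The normalization is a diagonal
matrix, invertible because the normalized matrices are unitary, so it changes neither the diagonal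
entries nor the traces and determinants. It is therefore enough to compute the unnormalized
matrices, and the Hermitian form enters only through unitarity. With `θ = π α / 4` one finds
`A = diag(e ^ (iθ), e ^ (-iθ))`, the rotation by `2 θ` about the first axis of the sphere of
imaginary unit quaternions, and `B` has determinant `1`, trace `√2` and upper left entry
`(1 + i cot θ) / √2`. Hence `B = (1 + n) / √2` (`su2_eq_quarterTurn`) is the quarter turn about a
unit vector `n` whose first coordinate is `cot θ`.

Density comes from a discreteness argument for the orbit `X` of `n` under the group `G` generated
by `A` and `B`. The set `X` is closed under quarter turns about its own points. If `v, w ∈ X` have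
inner product `t`, then `v` turned about `w` and `w` turned the other way about `v` have inner
product `1 - t ^ 2 + t ^ 3`, which lies strictly between `t` and `1` if `0 < t < 1`; iterating,
`X` contains distinct points that are arbitrarily close (`exists_close_pair`). So `X` is dense in the
sphere (`mem_closure_of_quarterTurns`): given a target `y` and `p ∈ X`, one of the four quarter
turns about `p` of a nearby point of `X` is closer to `y` than `p`, by a definite amount as long as
`p` is close neither to `y` nor to `-y`. The elements of `X` lie in `G`, being squares of conjugates
of `B`, and every element of `SU(2)` is a product of two imaginary unit quaternions
(`exists_imQuat_mul_imQuat`), so `G` is dense (`dense_closure_of_quarterTurn`).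

The argument starts as soon as `X` contains two points whose inner product is not `0` or `± 1`. For
`n` and its image under `A`, the inner product `t` satisfies `(1 - C) t = 1 + C - 2 C ^ 2` with
`C = cos (π α / 2)`, so it takes an excluded value only if `C ∈ {0, 1, -1, -1/2}`, that is, if `α`
is an integer or `α ≡ 2 ± 2/3` modulo `4`. In the latter case `X` is the set of vertices of an
octahedron.
-/

namespace NonssIsing

/-! ### Quarter-turn orbits on the sphere -/

/-- The quarter turn about a unit vector `v` sends `w` to `⟨v, w⟩ v + v × w`. Its square and its
third power are the half turn and the inverse quarter turn. -/
theorem halfTurn_mem_and_quarterTurn_inv_mem {X : Set (Fin 3 → ℝ)} (hX : ∀ v ∈ X, v ⬝ᵥ v = 1)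
    (hrot : ∀ v ∈ X, ∀ w ∈ X, (v ⬝ᵥ w) • v + v ⨯₃ w ∈ X) {v w : Fin 3 → ℝ}
    (hv : v ∈ X) (hw : w ∈ X) :
    (2 * (v ⬝ᵥ w)) • v - w ∈ X ∧ (v ⬝ᵥ w) • v - v ⨯₃ w ∈ X := by
  have h1 := hX v hv
  have key : ∀ z : Fin 3 → ℝ, (v ⬝ᵥ ((v ⬝ᵥ z) • v + v ⨯₃ z)) • v +
      v ⨯₃ ((v ⬝ᵥ z) • v + v ⨯₃ z) = (2 * (v ⬝ᵥ z)) • v - z := by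
    intro z
    have h2 : v ⨯₃ (v ⨯₃ z) = (v ⬝ᵥ z) • v - z := by
      rw [cross_cross_eq_smul_sub_smul', h1, one_smul]
    rw [dotProduct_add, dotProduct_smul, h1, dot_self_cross, map_add, map_smul, cross_self, h2]
    module
  have h2 := hrot v hv _ (hrot v hv w hw)
  rw [key] at h2
  refine ⟨h2, ?_⟩
  have h3 := hrot v hv _ h2
  have e1 : v ⬝ᵥ ((2 * (v ⬝ᵥ w)) • v - w) = v ⬝ᵥ w := by
    rw [dotProduct_sub, dotProduct_smul, h1, smul_eq_mul]; ring
  rw [e1, map_sub, map_smul, cross_self, smul_zero, zero_sub, ← sub_eq_add_neg] at h3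
  exact h3

/-- If a set of unit vectors is closed under quarter turns about its own points and contains two
vectors that are neither equal, opposite nor orthogonal, then it contains distinct vectors that
are arbitrarily close: turning `v` about `w` and `w` about `v` in opposite senses replaces the
inner product `t` by `1 - t ^ 2 + t ^ 3`, and the iteration increases to `1`. -/
theorem exists_close_pair {X : Set (Fin 3 → ℝ)} (hX : ∀ v ∈ X, v ⬝ᵥ v = 1)
    (hrot : ∀ v ∈ X, ∀ w ∈ X, (v ⬝ᵥ w) • v + v ⨯₃ w ∈ X)
    (hne : ∃ v ∈ X, ∃ w ∈ X, v ⬝ᵥ w ≠ 0 ∧ v ⬝ᵥ w ≠ 1 ∧ v ⬝ᵥ w ≠ -1) {ε : ℝ} (hε : 0 < ε) :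
    ∃ v ∈ X, ∃ w ∈ X, 0 < v ⬝ᵥ w ∧ v ⬝ᵥ w < 1 ∧ 1 - v ⬝ᵥ w < ε := by
  have gram : ∀ v ∈ X, ∀ w ∈ X, (v ⨯₃ w) ⬝ᵥ (v ⨯₃ w) = 1 - (v ⬝ᵥ w) ^ 2 := by
    intro v hv w hw
    rw [cross_dot_cross, hX v hv, hX w hw, dotProduct_comm w v]; ring
  -- A quarter turn of `w` replaces `t` by `t ^ 2`, which makes it positive.
  have start : ∃ v ∈ X, ∃ w ∈ X, 0 < v ⬝ᵥ w ∧ v ⬝ᵥ w < 1 := by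
    obtain ⟨v, hv, w, hw, h0, h1, h2⟩ := hne
    refine ⟨w, hw, _, hrot v hv w hw, ?_⟩
    have e : w ⬝ᵥ ((v ⬝ᵥ w) • v + v ⨯₃ w) = (v ⬝ᵥ w) ^ 2 := by
      rw [dotProduct_add, dotProduct_smul, dot_cross_self, dotProduct_comm w v, smul_eq_mul]; ring
    have h3 : 0 ≤ 1 - (v ⬝ᵥ w) ^ 2 := by
      rw [← gram v hv w hw]
      exact Finset.sum_nonneg fun i _ => mul_self_nonneg _
    have h4 : (v ⬝ᵥ w) ^ 2 ≠ 1 := by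
      rw [Ne, sq_eq_one_iff]; tauto
    rw [e]
    exact ⟨by positivity, lt_of_le_of_ne (by linarith) h4⟩
  have step : ∀ v ∈ X, ∀ w ∈ X, ∃ r ∈ X, ∃ s ∈ X,
      r ⬝ᵥ s = 1 - (v ⬝ᵥ w) ^ 2 + (v ⬝ᵥ w) ^ 3 := by
    intro v hv w hw
    refine ⟨_, (halfTurn_mem_and_quarterTurn_inv_mem hX hrot hw hv).2, _, hrot v hv w hw, ?_⟩
    rw [← cross_anticomm v w, dotProduct_comm w v, sub_neg_eq_add]
    simp only [dotProduct_add, add_dotProduct, dotProduct_smul, smul_dotProduct, smul_eq_mul,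
      dot_cross_self, gram v hv w hw, dotProduct_comm _ v, dot_self_cross]
    ring
  -- One step multiplies `1 - t` by `t ^ 2`, which is at most `1 - ε` as long as `1 - t ≥ ε`.
  have iter : ∀ k : ℕ, ∃ v ∈ X, ∃ w ∈ X, 0 < v ⬝ᵥ w ∧ v ⬝ᵥ w < 1 ∧
      (1 - v ⬝ᵥ w < ε ∨ 1 - v ⬝ᵥ w ≤ (1 - ε) ^ k) := by
    intro k
    induction k with
    | zero =>
      obtain ⟨v, hv, w, hw, h0, h1⟩ := start
      exact ⟨v, hv, w, hw, h0, h1, Or.inr (by rw [pow_zero]; linarith)⟩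
    | succ k ih =>
      obtain ⟨v, hv, w, hw, h0, h1, h2⟩ := ih
      by_cases h3 : 1 - v ⬝ᵥ w < ε
      · exact ⟨v, hv, w, hw, h0, h1, Or.inl h3⟩
      have h4 := h2.resolve_left h3
      push Not at h3
      obtain ⟨r, hr, s, hs, hrs⟩ := step v hv w hw
      set t := v ⬝ᵥ w
      have e : 1 - r ⬝ᵥ s = t * (t * (1 - t)) := by rw [hrs]; ring
      have h5 : 0 < t * (t * (1 - t)) := mul_pos h0 (mul_pos h0 (by linarith))
      have h6 : t * (t * (1 - t)) ≤ (1 - ε) ^ (k + 1) := by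
        rw [pow_succ']
        have : t * (1 - t) ≤ (1 - ε) ^ k := by nlinarith
        exact mul_le_mul (by linarith) this (mul_nonneg h0.le (by linarith)) (by linarith)
      have h7 : t * (t * (1 - t)) < 1 := by nlinarith
      exact ⟨r, hr, s, hs, by linarith, by linarith, Or.inr (by linarith)⟩
  by_cases h1 : 1 ≤ ε
  · obtain ⟨v, hv, w, hw, h0, h1, -⟩ := iter 0
    exact ⟨v, hv, w, hw, h0, h1, by linarith⟩
  · obtain ⟨k, hk⟩ := exists_pow_lt_of_lt_one hε (show 1 - ε < 1 by linarith)
    obtain ⟨v, hv, w, hw, h0, h2, h3⟩ := iter k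
    exact ⟨v, hv, w, hw, h0, h2, h3.elim id fun h => h.trans_lt hk⟩

/-- Both sides are the product of the squared lengths of the components of `y` and `w` orthogonal to
`p`; on the left, `w - ⟨p, w⟩ p` and `p × w` are orthogonal vectors of equal length that span the
plane orthogonal to `p`. -/
theorem sq_add_sq_gram (y p w : Fin 3 → ℝ) (hy : y ⬝ᵥ y = 1) (hp : p ⬝ᵥ p = 1)
    (hw : w ⬝ᵥ w = 1) :
    (y ⬝ᵥ w - (p ⬝ᵥ w) * (y ⬝ᵥ p)) ^ 2 + (y ⬝ᵥ p ⨯₃ w) ^ 2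
      = (1 - (y ⬝ᵥ p) ^ 2) * (1 - (p ⬝ᵥ w) ^ 2) := by
  have h : (y ⬝ᵥ p ⨯₃ w) ^ 2 = (y ⬝ᵥ y) * ((p ⬝ᵥ p) * (w ⬝ᵥ w) - (p ⬝ᵥ w) ^ 2)
      - (y ⬝ᵥ p) * ((y ⬝ᵥ p) * (w ⬝ᵥ w) - (p ⬝ᵥ w) * (y ⬝ᵥ w))
      + (y ⬝ᵥ w) * ((y ⬝ᵥ p) * (p ⬝ᵥ w) - (p ⬝ᵥ p) * (y ⬝ᵥ w)) := by
    simp only [cross_apply, dotProduct, Fin.sum_univ_three, Matrix.cons_val]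
    ring
  rw [h, hy, hp, hw]
  ring

/-- A set of unit vectors that is closed under quarter turns about its own points, looks the same
from each of its points, and contains two vectors that are neither equal, opposite nor orthogonal
is dense in the sphere. -/
theorem mem_closure_of_quarterTurns {X : Set (Fin 3 → ℝ)} (hX : ∀ v ∈ X, v ⬝ᵥ v = 1)
    (hrot : ∀ v ∈ X, ∀ w ∈ X, (v ⬝ᵥ w) • v + v ⨯₃ w ∈ X)
    (hhom : ∀ u ∈ X, ∀ v ∈ X, ∀ w ∈ X, ∃ u' ∈ X, u ⬝ᵥ u' = v ⬝ᵥ w)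
    (hne : ∃ v ∈ X, ∃ w ∈ X, v ⬝ᵥ w ≠ 0 ∧ v ⬝ᵥ w ≠ 1 ∧ v ⬝ᵥ w ≠ -1)
    {y : Fin 3 → ℝ} (hy : y ⬝ᵥ y = 1) : y ∈ closure X := by
  have dist_sq : ∀ p, p ⬝ᵥ p = 1 → ∀ i, (y i - p i) ^ 2 ≤ 2 - 2 * (y ⬝ᵥ p) := by
    intro p hp i
    have h1 : (y - p) ⬝ᵥ (y - p) = 2 - 2 * (y ⬝ᵥ p) := by
      rw [sub_dotProduct, dotProduct_sub, dotProduct_sub, hy, hp, dotProduct_comm p y]; ring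
    rw [← h1, sq]
    exact Finset.single_le_sum (f := fun i => (y - p) i * (y - p) i)
      (fun i _ => mul_self_nonneg _) (Finset.mem_univ i)
  have dot_le : ∀ p, p ⬝ᵥ p = 1 → y ⬝ᵥ p ≤ 1 := fun p hp => by
    have := (sq_nonneg _).trans (dist_sq p hp 0); linarith
  have approx : ∀ η > 0, ∃ p ∈ X, 1 - η < y ⬝ᵥ p := by
    intro η hη
    by_contra! hcon
    -- Not every point of `X` is `-y`, as `X` has at least two points.
    obtain ⟨p₀, hp₀, hs₀⟩ : ∃ p ∈ X, -1 < y ⬝ᵥ p := by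
      by_contra! h
      obtain ⟨v, hv, w, hw, -, h1, -⟩ := hne
      have anti : ∀ p ∈ X, p = -y := by
        intro p hp
        have hp1 := hX p hp
        have h2 : (y + p) ⬝ᵥ (y + p) ≤ 0 := by
          rw [add_dotProduct, dotProduct_add, dotProduct_add, hy, hp1, dotProduct_comm p y]
          linarith [h p hp]
        have h3 : y + p = 0 := dotProduct_self_eq_zero.1
          (le_antisymm h2 (Finset.sum_nonneg fun i _ => mul_self_nonneg _))
        exact eq_neg_of_add_eq_zero_right h3
      rw [anti v hv, anti w hw, neg_dotProduct_neg, hy] at h1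
      exact h1 rfl
    -- A lower bound for `1 - s ^ 2` when `s` lies between `⟨y, p₀⟩` and `1 - η`.
    set κ := η * (1 + y ⬝ᵥ p₀)
    have hκ0 : 0 < κ := mul_pos hη (by linarith)
    obtain ⟨v, hv, w, hw, ht0, ht1, htκ⟩ :=
      exists_close_pair hX hrot hne (show 0 < κ / 8 by linarith)
    set t := v ⬝ᵥ w with ht
    -- Among the images under quarter turns about `p` of a neighbour at inner product `t`, one has
    -- inner product with `y` at least `1 - t` larger than that of `p`: the tangential gain is at
    -- least `√(κ (1 - t) / 2) ≥ 2 (1 - t)` because `1 - t < κ / 8`, and the radial loss at most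
    -- `1 - t`.
    have climb : ∀ k : ℕ, ∃ p ∈ X, y ⬝ᵥ p₀ + k * (1 - t) ≤ y ⬝ᵥ p := by
      intro k
      induction k with
      | zero => exact ⟨p₀, hp₀, by simp⟩
      | succ k ih =>
        obtain ⟨p, hp, hpk⟩ := ih
        obtain ⟨p', hp', hpp⟩ := hhom p hp v hv w hw
        rw [← ht] at hpp
        have g := sq_add_sq_gram y p p' hy (hX p hp) (hX p' hp')
        obtain ⟨m2, m3⟩ := halfTurn_mem_and_quarterTurn_inv_mem hX hrot hp hp'
        have m1 := hrot p hp p' hp'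
        rw [hpp] at g m1 m2 m3
        set s := y ⬝ᵥ p
        have d1 : y ⬝ᵥ (t • p + p ⨯₃ p') = t * s + y ⬝ᵥ p ⨯₃ p' := by
          rw [dotProduct_add, dotProduct_smul, smul_eq_mul]
        have d2 : y ⬝ᵥ ((2 * t) • p - p') = t * s - (y ⬝ᵥ p' - t * s) := by
          rw [dotProduct_sub, dotProduct_smul, smul_eq_mul]; ring
        have d3 : y ⬝ᵥ (t • p - p ⨯₃ p') = t * s - y ⬝ᵥ p ⨯₃ p' := by
          rw [dotProduct_sub, dotProduct_smul, smul_eq_mul]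
        set a := y ⬝ᵥ p' - t * s with ha
        set b := y ⬝ᵥ p ⨯₃ p'
        have hs1 : s ≤ 1 - η := hcon p hp
        have hs2 : y ⬝ᵥ p₀ ≤ s := by
          have : 0 ≤ (k : ℝ) * (1 - t) := mul_nonneg k.cast_nonneg (by linarith)
          linarith
        have hs3 : κ ≤ 1 - s ^ 2 := by
          have : η * (1 + y ⬝ᵥ p₀) ≤ (1 - s) * (1 + s) :=
            mul_le_mul (by linarith) (by linarith) (by linarith) (by linarith)
          nlinarith
        have hab : 2 * (2 * (1 - t)) ^ 2 ≤ a ^ 2 + b ^ 2 := by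
          rw [g]
          have h1 : κ * (1 - t) ≤ (1 - s ^ 2) * (1 - t ^ 2) :=
            mul_le_mul hs3 (by nlinarith) (by linarith) (by linarith)
          nlinarith
        have hcase : 2 * (1 - t) ≤ |a| ∨ 2 * (1 - t) ≤ |b| := by
          by_contra! h
          have h1 := sq_lt_sq' (by linarith [abs_nonneg a]) h.1
          have h2 := sq_lt_sq' (by linarith [abs_nonneg b]) h.2
          rw [sq_abs] at h1 h2
          linarith
        have hts : s - (1 - t) ≤ t * s := by nlinarith
        push_cast
        rcases hcase with h | h <;> rcases le_abs.1 h with h | h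
        · exact ⟨p', hp', by rw [ha] at h; linarith⟩
        · exact ⟨_, m2, by rw [d2]; linarith⟩
        · exact ⟨_, m1, by rw [d1]; linarith⟩
        · exact ⟨_, m3, by rw [d3]; linarith⟩
    obtain ⟨k, hk⟩ := exists_nat_gt (2 / (1 - t))
    obtain ⟨p, hp, hpk⟩ := climb k
    have := dot_le p (hX p hp)
    rw [div_lt_iff₀ (by linarith)] at hk
    linarith
  rw [Metric.mem_closure_iff]
  intro ε hε
  obtain ⟨p, hp, hlt⟩ := approx (ε ^ 2 / 2) (by positivity)
  refine ⟨p, hp, (dist_pi_lt_iff hε).2 fun i => ?_⟩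
  rw [Real.dist_eq]
  refine abs_lt_of_sq_lt_sq ?_ hε.le
  have := dist_sq p (hX p hp) i
  linarith

/-! ### Two generators of `SU(2)` -/

/-- The purely imaginary quaternion with coordinate vector `v`, as a skew-Hermitian traceless
matrix: the unit vectors go to `i = diag(I, -I)`, `j = !![0, 1; -1, 0]` and `k = i j`, so that the
first coordinate axis is the axis of the diagonal matrices. -/
def imQuat (v : Fin 3 → ℝ) : Matrix (Fin 2) (Fin 2) ℂ :=
  !![Complex.I * v 0, v 1 + Complex.I * v 2; -v 1 + Complex.I * v 2, -(Complex.I * v 0)]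

theorem imQuat_mul (v w : Fin 3 → ℝ) :
    imQuat v * imQuat w = (-(v ⬝ᵥ w : ℝ) : ℂ) • 1 + imQuat (v ⨯₃ w) := by
  have hI := Complex.I_mul_I
  simp only [imQuat, cross_apply, dotProduct, Fin.sum_univ_three]
  ext i j
  fin_cases i <;> fin_cases j <;> simp [Matrix.mul_apply] <;> grind

theorem star_imQuat (v : Fin 3 → ℝ) : star (imQuat v) = -imQuat v := by
  ext i j
  fin_cases i <;> fin_cases j <;> simp [imQuat] <;> ring

theorem imQuat_add (v w : Fin 3 → ℝ) : imQuat (v + w) = imQuat v + imQuat w := by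
  ext i j
  fin_cases i <;> fin_cases j <;> simp [imQuat] <;> ring

theorem imQuat_smul (a : ℝ) (v : Fin 3 → ℝ) : imQuat (a • v) = (a : ℂ) • imQuat v := by
  ext i j
  fin_cases i <;> fin_cases j <;> simp [imQuat] <;> ring

theorem trace_imQuat (v : Fin 3 → ℝ) : (imQuat v).trace = 0 := by
  simp [imQuat, Matrix.trace_fin_two]

theorem trace_imQuat_mul (v w : Fin 3 → ℝ) :
    (imQuat v * imQuat w).trace = ((-2 * (v ⬝ᵥ w) : ℝ) : ℂ) := by
  rw [imQuat_mul, Matrix.trace_add, trace_imQuat, Matrix.trace_smul, Matrix.trace_one]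
  simp
  ring

theorem continuous_imQuat : Continuous imQuat := by
  unfold imQuat
  refine continuous_matrix fun i j => ?_
  fin_cases i <;> fin_cases j <;> simp <;> fun_prop

theorem exists_imQuat {M : Matrix (Fin 2) (Fin 2) ℂ} (h1 : star M = -M) (h2 : M.trace = 0) :
    ∃ v, imQuat v = M := by
  refine ⟨![(M 0 0).im, (M 0 1).re, (M 0 1).im], ?_⟩
  have e00 := congrFun (congrFun h1 0) 0
  have e10 := congrFun (congrFun h1 1) 0
  rw [Matrix.trace_fin_two] at h2
  simp only [Matrix.star_apply, Matrix.neg_apply] at e00 e10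
  have r00 := congrArg Complex.re e00
  simp at r00
  have r11 : M 1 1 = -M 0 0 := by linear_combination h2
  have r10 : M 1 0 = -star (M 0 1) := by rw [e10, neg_neg]
  have e0 : Complex.I * ((M 0 0).im : ℂ) = M 0 0 := by
    apply Complex.ext <;> simp
    linarith
  ext i j
  fin_cases i <;> fin_cases j
  · simpa [imQuat] using e0
  · apply Complex.ext <;> simp [imQuat]
  · simp only [imQuat, Fin.mk_one, Fin.zero_eta, r10]
    apply Complex.ext <;> simp
  · simpa [imQuat, r11] using e0

theorem su2_apply {U : Matrix (Fin 2) (Fin 2) ℂ} (hU : U ∈ Matrix.specialUnitaryGroup (Fin 2) ℂ) :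
    U 1 1 = star (U 0 0) ∧ U 1 0 = -star (U 0 1) := by
  obtain ⟨h1, h2⟩ := Matrix.mem_specialUnitaryGroup_iff.1 hU
  have h3 : star U = U.adjugate := by
    have h4 : star U * U = 1 := Matrix.mem_unitaryGroup_iff'.1 h1
    calc star U = star U * (U * U.adjugate) := by rw [Matrix.mul_adjugate, h2, one_smul, mul_one]
      _ = U.adjugate := by rw [← mul_assoc, h4, one_mul]
  rw [Matrix.adjugate_fin_two] at h3
  have e00 := congrFun (congrFun h3 0) 0
  have e10 := congrFun (congrFun h3 1) 0
  simp [Matrix.star_apply] at e00 e10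
  exact ⟨e00.symm, by rw [← neg_eq_iff_eq_neg]; exact e10.symm⟩

theorem imQuat_mem {v : Fin 3 → ℝ} (hv : v ⬝ᵥ v = 1) :
    imQuat v ∈ Matrix.specialUnitaryGroup (Fin 2) ℂ := by
  rw [Matrix.mem_specialUnitaryGroup_iff]
  constructor
  · rw [Matrix.mem_unitaryGroup_iff, star_imQuat, mul_neg, imQuat_mul, hv, cross_self]
    ext i j
    fin_cases i <;> fin_cases j <;> simp [imQuat]
  · have hI := Complex.I_mul_I
    have h : ((v ⬝ᵥ v : ℝ) : ℂ) = 1 := by rw [hv]; simp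
    simp only [dotProduct, Fin.sum_univ_three] at h
    push_cast at h
    rw [imQuat, Matrix.det_fin_two_of]
    linear_combination h - ((v 0 : ℂ) ^ 2 + (v 2 : ℂ) ^ 2) * hI

/-- Every element of `SU(2)` is a product of two imaginary unit quaternions: if `U = a + x` with
`x` imaginary and `u` is a unit vector orthogonal to `x`, then `- u U` is imaginary. -/
theorem exists_imQuat_mul_imQuat {U : Matrix (Fin 2) (Fin 2) ℂ}
    (hU : U ∈ Matrix.specialUnitaryGroup (Fin 2) ℂ) :
    ∃ u v : Fin 3 → ℝ, u ⬝ᵥ u = 1 ∧ v ⬝ᵥ v = 1 ∧ U = imQuat u * imQuat v := by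
  obtain ⟨h11, h10⟩ := su2_apply hU
  obtain ⟨u, hu, hux⟩ : ∃ u : Fin 3 → ℝ, u ⬝ᵥ u = 1 ∧
      u 0 * (U 0 0).im + u 1 * (U 0 1).re + u 2 * (U 0 1).im = 0 := by
    set a := (U 0 0).im
    set b := (U 0 1).re
    by_cases h : a ^ 2 + b ^ 2 = 0
    · have ha : a = 0 := by nlinarith [sq_nonneg a, sq_nonneg b]
      have hb : b = 0 := by nlinarith [sq_nonneg a, sq_nonneg b]
      exact ⟨![1, 0, 0], by simp, by simp [ha]⟩
    · have hpos : 0 < a ^ 2 + b ^ 2 := lt_of_le_of_ne (by positivity) (Ne.symm h)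
      have hs := Real.sq_sqrt hpos.le
      have hs0 : √(a ^ 2 + b ^ 2) ≠ 0 := (Real.sqrt_pos.2 hpos).ne'
      refine ⟨![-b / √(a ^ 2 + b ^ 2), a / √(a ^ 2 + b ^ 2), 0], ?_, ?_⟩
      · simp only [dotProduct, Fin.sum_univ_three, Matrix.cons_val]
        field_simp
        linarith
      · simp only [Matrix.cons_val]
        field_simp
        ring
  have hmem : star (imQuat u) * U ∈ Matrix.specialUnitaryGroup (Fin 2) ℂ := by
    have := imQuat_mem hu
    exact mul_mem (star (⟨_, this⟩ : Matrix.specialUnitaryGroup (Fin 2) ℂ)).2 hU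
  have htr : (star (imQuat u) * U).trace = 0 := by
    rw [star_imQuat, Matrix.trace_fin_two]
    simp only [imQuat, Matrix.neg_apply, Matrix.mul_apply, Fin.sum_univ_two,
      Matrix.of_apply, Matrix.cons_val, h11, h10]
    apply Complex.ext <;> simp <;> linarith
  have hskew : star (star (imQuat u) * U) = -(star (imQuat u) * U) := by
    set W := star (imQuat u) * U
    obtain ⟨w11, w10⟩ := su2_apply hmem
    rw [Matrix.trace_fin_two, w11] at htr
    ext i j
    fin_cases i <;> fin_cases j <;> simp only [Matrix.star_apply, Matrix.neg_apply, Fin.mk_one,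
      Fin.zero_eta, Fin.isValue]
    · linear_combination htr
    · rw [w10]; simp
    · rw [w10]; simp
    · rw [w11, star_star]; linear_combination htr
  obtain ⟨v, hv⟩ := exists_imQuat hskew htr
  have huu : imQuat u * star (imQuat u) = 1 :=
    Matrix.mem_unitaryGroup_iff.1 (Matrix.mem_specialUnitaryGroup_iff.1 (imQuat_mem hu)).1
  refine ⟨u, v, hu, ?_, ?_⟩
  · have h1 : imQuat v * star (imQuat v) = 1 := by
      rw [hv]
      exact Matrix.mem_unitaryGroup_iff.1 (Matrix.mem_specialUnitaryGroup_iff.1 hmem).1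
    have h2 := congrArg Matrix.trace h1
    rw [star_imQuat, mul_neg, Matrix.trace_neg, trace_imQuat_mul, Matrix.trace_one] at h2
    have h3 : ((2 * (v ⬝ᵥ v) : ℝ) : ℂ) = ((2 : ℝ) : ℂ) := by
      push_cast at h2 ⊢
      rw [Fintype.card_fin] at h2
      linear_combination h2
    have := Complex.ofReal_injective h3
    linarith
  · rw [hv, ← mul_assoc, huu, one_mul]

theorem dotProduct_eq_of_conj {k : Matrix (Fin 2) (Fin 2) ℂ}
    (hk : star k * k = 1) {u u' v v' : Fin 3 → ℝ} (h : k * imQuat v * star k = imQuat u)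
    (h' : k * imQuat v' * star k = imQuat u') : u ⬝ᵥ u' = v ⬝ᵥ v' := by
  have h1 : (imQuat u * imQuat u').trace = (imQuat v * imQuat v').trace := by
    rw [← h, ← h']
    have : k * imQuat v * star k * (k * imQuat v' * star k)
        = k * (imQuat v * (star k * k) * imQuat v' * star k) := by simp only [mul_assoc]
    rw [this, hk, mul_one, Matrix.trace_mul_comm, mul_assoc, hk, mul_one]
  rw [trace_imQuat_mul, trace_imQuat_mul] at h1
  have := Complex.ofReal_injective h1
  linarith

theorem exists_imQuat_conj {k : Matrix (Fin 2) (Fin 2) ℂ} (hk : star k * k = 1)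
    (v : Fin 3 → ℝ) : ∃ u, imQuat u = k * imQuat v * star k := by
  refine exists_imQuat ?_ ?_
  · rw [star_mul, star_mul, star_star, star_imQuat, neg_mul, mul_neg, mul_assoc]
  · rw [Matrix.trace_mul_comm, ← mul_assoc, hk, one_mul, trace_imQuat]

/-- `(1 + v) / √2` acts on imaginary quaternions as the quarter turn about `v`. -/
theorem quarterTurn_conj {v : Fin 3 → ℝ} (hv : v ⬝ᵥ v = 1) (w : Fin 3 → ℝ) :
    (((√2)⁻¹ : ℝ) : ℂ) • (1 + imQuat v) * imQuat w * star ((((√2)⁻¹ : ℝ) : ℂ) • (1 + imQuat v))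
      = imQuat ((v ⬝ᵥ w) • v + v ⨯₃ w) := by
  have hs : (((√2)⁻¹ : ℝ) : ℂ) * (((√2)⁻¹ : ℝ) : ℂ) = 1 / 2 := by
    rw [← Complex.ofReal_mul, ← mul_inv, Real.mul_self_sqrt (by norm_num)]
    norm_num
  have e1 : imQuat v * imQuat w * imQuat v = (-(2 * (v ⬝ᵥ w)) : ℂ) • imQuat v + imQuat w := by
    have h1 : imQuat v * imQuat v = -1 := by
      have hz : imQuat 0 = 0 := by
        ext i j
        fin_cases i <;> fin_cases j <;> simp [imQuat]
      rw [imQuat_mul, hv, cross_self, hz]; simp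
    have h2 : imQuat w * imQuat v = (-(2 * (v ⬝ᵥ w)) : ℂ) • 1 - imQuat v * imQuat w := by
      have h3 : imQuat (w ⨯₃ v) = -imQuat (v ⨯₃ w) := by
        rw [← cross_anticomm, ← neg_one_smul ℝ, imQuat_smul]; simp
      rw [imQuat_mul, imQuat_mul, h3, dotProduct_comm w v]
      module
    rw [mul_assoc, h2, mul_sub, ← mul_assoc, h1, mul_smul_comm, mul_one]
    simp
  have e2 : imQuat v * imQuat w - imQuat w * imQuat v = (2 : ℂ) • imQuat (v ⨯₃ w) := by
    have h3 : imQuat (w ⨯₃ v) = -imQuat (v ⨯₃ w) := by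
      rw [← cross_anticomm, ← neg_one_smul ℝ, imQuat_smul]; simp
    rw [imQuat_mul, imQuat_mul, h3, dotProduct_comm w v]
    module
  rw [star_smul, star_add, star_one, star_imQuat, smul_mul_assoc, smul_mul_assoc, mul_smul_comm,
    smul_smul, Complex.star_def, Complex.conj_ofReal, hs, imQuat_add, imQuat_smul]
  have e3 : (1 + imQuat v) * imQuat w * (1 + -imQuat v) = imQuat w +
      (imQuat v * imQuat w - imQuat w * imQuat v) - imQuat v * imQuat w * imQuat v := by
    noncomm_ring
  rw [e3, e1, e2]
  module

/-- If `B ∈ SU(2)` is a quarter turn about `n` and `A ∈ SU(2)` moves `n` to a vector that is neither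
equal, opposite nor orthogonal to `n`, then `A` and `B` generate a dense subgroup: the orbit of `n`
is dense in the sphere, its elements lie in the subgroup as squares of conjugates of `B`, and
every element of `SU(2)` is a product of two imaginary unit quaternions. -/
theorem dense_closure_of_quarterTurn (A B : Matrix.specialUnitaryGroup (Fin 2) ℂ)
    {n w : Fin 3 → ℝ} (hn : n ⬝ᵥ n = 1)
    (hB : (B : Matrix (Fin 2) (Fin 2) ℂ) = (((√2)⁻¹ : ℝ) : ℂ) • (1 + imQuat n))
    (hA : (A : Matrix (Fin 2) (Fin 2) ℂ) * imQuat n * star (A : Matrix (Fin 2) (Fin 2) ℂ)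
      = imQuat w)
    (h0 : n ⬝ᵥ w ≠ 0) (h1 : n ⬝ᵥ w ≠ 1) (h2 : n ⬝ᵥ w ≠ -1) :
    Dense ((Subgroup.closure {A, B} : Subgroup (Matrix.specialUnitaryGroup (Fin 2) ℂ)) :
      Set (Matrix.specialUnitaryGroup (Fin 2) ℂ)) := by
  set G : Subgroup (Matrix.specialUnitaryGroup (Fin 2) ℂ) := Subgroup.closure {A, B}
  have hAG : A ∈ G := Subgroup.subset_closure (by simp)
  have hBG : B ∈ G := Subgroup.subset_closure (by simp)
  have unit : ∀ k : Matrix.specialUnitaryGroup (Fin 2) ℂ, star k.1 * k.1 = 1 := fun k =>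
    Matrix.mem_unitaryGroup_iff'.1 (Matrix.mem_specialUnitaryGroup_iff.1 k.2).1
  have coe_inv : ∀ k : Matrix.specialUnitaryGroup (Fin 2) ℂ, (k⁻¹).1 = star k.1 := fun k => rfl
  set X : Set (Fin 3 → ℝ) := {v | ∃ g ∈ G, g.1 * imQuat n * star g.1 = imQuat v}
  have hX : ∀ v ∈ X, v ⬝ᵥ v = 1 := by
    rintro v ⟨g, -, hg⟩
    rw [dotProduct_eq_of_conj (unit g) hg hg, hn]
  have conjB : ∀ (g : Matrix.specialUnitaryGroup (Fin 2) ℂ) (v : Fin 3 → ℝ),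
      g.1 * imQuat n * star g.1 = imQuat v →
      (g * B * g⁻¹).1 = (((√2)⁻¹ : ℝ) : ℂ) • (1 + imQuat v) := by
    intro g v hg
    have h3 : g.1 * star g.1 = 1 :=
      Matrix.mem_unitaryGroup_iff.1 (Matrix.mem_specialUnitaryGroup_iff.1 g.2).1
    rw [Submonoid.coe_mul, Submonoid.coe_mul, coe_inv, hB, mul_smul_comm, smul_mul_assoc, mul_add,
      add_mul, hg, mul_one, h3]
  have hrot : ∀ v ∈ X, ∀ w ∈ X, (v ⬝ᵥ w) • v + v ⨯₃ w ∈ X := by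
    rintro v ⟨g, hgG, hg⟩ w ⟨h, hhG, hh⟩
    refine ⟨g * B * g⁻¹ * h, G.mul_mem (G.mul_mem (G.mul_mem hgG hBG) (G.inv_mem hgG)) hhG, ?_⟩
    rw [← quarterTurn_conj (hX v ⟨g, hgG, hg⟩), ← hh, ← conjB g v hg]
    rw [Submonoid.coe_mul _ _ h, star_mul]
    simp only [mul_assoc]
  have hhom : ∀ u ∈ X, ∀ v ∈ X, ∀ w ∈ X, ∃ u' ∈ X, u ⬝ᵥ u' = v ⬝ᵥ w := by
    rintro u ⟨g₁, hg₁, e₁⟩ v ⟨g₂, hg₂, e₂⟩ w ⟨g₃, hg₃, e₃⟩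
    obtain ⟨u', hu'⟩ := exists_imQuat_conj (unit (g₁ * g₂⁻¹)) w
    refine ⟨u', ⟨g₁ * g₂⁻¹ * g₃, G.mul_mem (G.mul_mem hg₁ (G.inv_mem hg₂)) hg₃, ?_⟩,
      dotProduct_eq_of_conj (unit (g₁ * g₂⁻¹)) ?_ hu'.symm⟩
    · rw [hu', ← e₃, Submonoid.coe_mul _ _ g₃, star_mul]
      simp only [mul_assoc]
    · rw [← e₁, ← e₂, Submonoid.coe_mul, coe_inv, star_mul, star_star]
      have : g₁.1 * star g₂.1 * (g₂.1 * imQuat n * star g₂.1) * (g₂.1 * star g₁.1)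
          = g₁.1 * (star g₂.1 * g₂.1) * imQuat n * (star g₂.1 * g₂.1) * star g₁.1 := by
        simp only [mul_assoc]
      rw [this, unit, mul_one, mul_one]
  have hdense : ∀ y : Fin 3 → ℝ, y ⬝ᵥ y = 1 → y ∈ closure X := fun y hy =>
    mem_closure_of_quarterTurns hX hrot hhom
      ⟨n, ⟨1, G.one_mem, by simp⟩, w, ⟨A, hAG, hA⟩, h0, h1, h2⟩ hy
  have hsub : imQuat '' X ⊆
      Subtype.val '' (G : Set (Matrix.specialUnitaryGroup (Fin 2) ℂ)) := by
    rintro _ ⟨v, ⟨g, hgG, hg⟩, rfl⟩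
    have hm := G.mul_mem (G.mul_mem hgG hBG) (G.inv_mem hgG)
    refine ⟨(g * B * g⁻¹) * (g * B * g⁻¹), G.mul_mem hm hm, ?_⟩
    have hv := hX v ⟨g, hgG, hg⟩
    have hs : (((√2)⁻¹ : ℝ) : ℂ) * (((√2)⁻¹ : ℝ) : ℂ) = 1 / 2 := by
      rw [← Complex.ofReal_mul, ← mul_inv, Real.mul_self_sqrt (by norm_num)]
      norm_num
    have h3 : imQuat v * imQuat v = -1 := by
      have := Matrix.mem_unitaryGroup_iff.1
        (Matrix.mem_specialUnitaryGroup_iff.1 (imQuat_mem hv)).1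
      rw [star_imQuat, mul_neg] at this
      rw [← this, neg_neg]
    rw [Submonoid.coe_mul, conjB g v hg, smul_mul_smul_comm, hs]
    have h4 : (1 + imQuat v) * (1 + imQuat v) = 1 + (2 : ℂ) • imQuat v + imQuat v * imQuat v := by
      rw [two_smul]; noncomm_ring
    rw [h4, h3]
    module
  have hunit : ∀ (u : Fin 3 → ℝ) (hu : u ⬝ᵥ u = 1),
      (⟨imQuat u, imQuat_mem hu⟩ : Matrix.specialUnitaryGroup (Fin 2) ℂ) ∈
        closure (G : Set (Matrix.specialUnitaryGroup (Fin 2) ℂ)) := by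
    intro u hu
    rw [closure_subtype]
    exact closure_mono hsub
      (image_closure_subset_closure_image continuous_imQuat ⟨u, hdense u hu, rfl⟩)
  intro U
  obtain ⟨u, v, hu, hv, hUuv⟩ := exists_imQuat_mul_imQuat U.2
  have hU : U = ⟨imQuat u, imQuat_mem hu⟩ * ⟨imQuat v, imQuat_mem hv⟩ := Subtype.ext hUuv
  rw [hU]
  exact map_mem_closure₂ continuous_mul (hunit u hu) (hunit v hv) fun a ha b hb => G.mul_mem ha hb

open WeightModule

/-! ### The braid matrices in the basis of fusion trees -/

/-!
An element of the one-qubit space is determined by its highest weight vector, and that by its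
coefficients at `v₀ ⊗ s₀ ⊗ s₁` and `v₀ ⊗ s₁ ⊗ s₀`, which are the indices `((0, 0), 1)` and
`((0, 1), 0)`. Only these are computed, together with the coefficient at `v₁ ⊗ s₀ ⊗ s₀`, which `b₁²`
mixes into the second one.
-/

theorem qpow_sub (x y : ℂ) : qpow (x - y) = qpow x * qpow (-y) := by
  rw [sub_eq_add_neg, qpow_add]

theorem qpow_three : qpow 3 = qpow 1 ^ 3 := by
  rw [show (3 : ℂ) = 1 + 1 + 1 by norm_num, qpow_add, qpow_add]; ring

theorem qpow_neg_one : qpow (-1) = -qpow 1 ^ 3 := by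
  have h := qpow_one_pow_four
  have h1 : qpow (-1) * qpow 1 = 1 := by rw [← qpow_add]; simp [qpow_zero]
  linear_combination qpow (-1) * h - qpow 1 ^ 3 * h1

theorem qpow_neg_three : qpow (-3) = -qpow 1 := by
  have h := qpow_one_pow_four
  rw [show (-3 : ℂ) = -1 + -1 + -1 by norm_num, qpow_add, qpow_add, qpow_neg_one]
  linear_combination (-qpow 1 ^ 5 + qpow 1) * h

theorem qnum_neg (z : ℂ) : qnum (-z) = -qnum z := by
  simp only [qnum, qbr, neg_neg]; ring

theorem ket_zero_snd (α : ℝ) : ketMat α 0 ((0, 1), 0) 0 = -qpow (-α) / qnum α := by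
  have h1 : qnum (1 - ((α : ℂ) + 1)) = -qnum α := by
    rw [← qnum_neg]; congr 1; ring
  have h2 := qpow_ne_zero 1
  simp [ketMat, Matrix.mul_apply, Fintype.sum_prod_type, Fin.sum_univ_four, Yplus, Yminus, lift,
    tensor, V, S1, Matrix.one_apply, Kinv]
  rw [qnum_neg, qpow_add, qpow_neg_three, inv_neg]
  field_simp

theorem ket_zero_trd (α : ℝ) : ketMat α 0 ((1, 0), 0) 0 = qpow (-1) / qnum α := by
  simp [ketMat, Matrix.mul_apply, Fintype.sum_prod_type, Fin.sum_univ_four, Yplus, Yminus, lift,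
    tensor, V, S1, Matrix.one_apply, Kinv]
  rw [qnum_neg, qpow_neg, inv_neg]
  ring

theorem ket_one_trd (α : ℝ) : ketMat α 1 ((1, 0), 0) 0 = -(qpow 1 * qnum (1 - α))⁻¹ := by
  simp [ketMat, Matrix.mul_apply, Yplus, Yminus, lift, tensor, V, S1, Matrix.one_apply, Kinv]

theorem b2_mul_apply_fst (f : Matrix ((Fin 4 × Fin 2) × Fin 2) (Fin 4) ℂ) :
    (b2 * f) ((0, 0), 1) 0 = qpow (-1 / 2) * f ((0, 1), 0) 0 := by
  rw [b2, braiding, Rmatrix_eq _ _ (Or.inl S1_E_sq)]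
  simp [Matrix.mul_apply, Fintype.sum_prod_type, Matrix.one_apply, WeightModule.flip, S1,
    Matrix.diagonal_apply]

theorem b2_mul_apply_snd (f : Matrix ((Fin 4 × Fin 2) × Fin 2) (Fin 4) ℂ) :
    (b2 * f) ((0, 1), 0) 0 = qpow (-1 / 2) * (f ((0, 0), 1) 0 + qbr 1 * f ((0, 1), 0) 0) := by
  rw [b2, braiding, Rmatrix_eq _ _ (Or.inl S1_E_sq)]
  simp [Matrix.mul_apply, Fintype.sum_prod_type, Matrix.one_apply, WeightModule.flip, S1,
    Matrix.diagonal_apply]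
  ring

theorem b1sq_mul_apply_fst (α : ℝ) (f : Matrix ((Fin 4 × Fin 2) × Fin 2) (Fin 4) ℂ) :
    (b1sq α * f) ((0, 0), 1) 0 = qpow (α + 3) * f ((0, 0), 1) 0 := by
  rw [b1sq, braiding, braiding, Rmatrix_eq _ _ (Or.inl S1_E_sq), Rmatrix_eq _ _ (Or.inr S1_F_sq)]
  simp [Matrix.mul_apply, Fintype.sum_prod_type, Fin.sum_univ_four, Matrix.one_apply,
    WeightModule.flip, S1, V, Matrix.diagonal_apply]
  left
  rw [← qpow_add, add_halves]

theorem b1sq_mul_apply_snd (α : ℝ) (f : Matrix ((Fin 4 × Fin 2) × Fin 2) (Fin 4) ℂ) :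
    (b1sq α * f) ((0, 1), 0) 0 =
      qpow (-α - 3) * (f ((0, 1), 0) 0 + qbr (1 - α) * f ((1, 0), 0) 0) := by
  rw [b1sq, braiding, braiding, Rmatrix_eq _ _ (Or.inl S1_E_sq), Rmatrix_eq _ _ (Or.inr S1_F_sq)]
  simp [Matrix.mul_apply, Fintype.sum_prod_type, Fin.sum_univ_four, Matrix.one_apply,
    WeightModule.flip, S1, V, Matrix.diagonal_apply]
  have h1 : qpow ((-3 + -(α : ℂ)) / 2) * qpow ((-3 + -(α : ℂ)) / 2) = qpow (-α - 3) := by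
    rw [← qpow_add]; congr 1; ring
  have h2 : qbr 1 * qnum (1 - α) = qbr (1 - α) := mul_div_cancel₀ _ qbr_one_ne_zero
  rw [qnum_one, ← h1, ← h2]
  ring

/-- The coordinates of an element of the one-qubit space in the basis of fusion trees. -/
theorem ketBasis_repr {α : ℝ} (hα : ∀ n : ℤ, α ≠ n) (f : H1 α) :
    (ketBasis hα).repr f 0 = f.1 ((0, 0), 1) 0 ∧
    (ketBasis hα).repr f 1 = f.1 ((0, 1), 0) 0 - f.1 ((0, 0), 1) 0 * ketMat α 0 ((0, 1), 0) 0 := by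
  have h : f = (ketBasis hα).repr f 0 • ket hα 0 + (ketBasis hα).repr f 1 • ket hα 1 := by
    have := (ketBasis hα).sum_repr f
    rw [Fin.sum_univ_two] at this
    simpa [ketBasis] using this.symm
  have hm : f.1 = (ketBasis hα).repr f 0 • ketMat α 0 + (ketBasis hα).repr f 1 • ketMat α 1 :=
    congrArg Subtype.val h
  have e0 := congrFun (congrFun hm ((0, 0), 1)) 0
  have e1 := congrFun (congrFun hm ((0, 1), 0)) 0
  simp only [Matrix.add_apply, Matrix.smul_apply, ket_zero_fst, ket_one_fst, ket_one_snd,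
    smul_eq_mul, mul_one, mul_zero, add_zero] at e0 e1
  exact ⟨e0.symm, by rw [e0]; linear_combination -e1⟩

theorem toMatrix_b2op {α : ℝ} (hα : ∀ n : ℤ, α ≠ n) :
    LinearMap.toMatrix (ketBasis hα) (ketBasis hα) (b2op α) =
      !![qpow (-1 / 2) * (-qpow (-α) / qnum α), qpow (-1 / 2);
        qpow (-1 / 2) * (1 + qbr 1 * (-qpow (-α) / qnum α) - (-qpow (-α) / qnum α) ^ 2),
        qpow (-1 / 2) * (qbr 1 - -qpow (-α) / qnum α)] := by
  ext i j
  rw [LinearMap.toMatrix_apply]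
  have hk : ∀ j, (b2op α (ketBasis hα j)).1 = b2 * ketMat α j := by
    intro j
    rw [ketBasis, Module.Basis.mk_apply]; rfl
  fin_cases i <;> fin_cases j <;>
    simp [(ketBasis_repr hα _).1, (ketBasis_repr hα _).2, hk, b2_mul_apply_fst, b2_mul_apply_snd,
      ket_zero_fst, ket_one_fst, ket_one_snd, ket_zero_snd] <;> ring

theorem toMatrix_J1op {α : ℝ} (hα : ∀ n : ℤ, α ≠ n) :
    LinearMap.toMatrix (ketBasis hα) (ketBasis hα) (J1op α) =
      !![qpow (α + 3), 0; 0, qpow (3 - α)] := by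
  ext i j
  rw [LinearMap.toMatrix_apply]
  have hk : ∀ j, (J1op α (ketBasis hα j)).1 = b1sq α * ketMat α j := by
    intro j
    rw [ketBasis, Module.Basis.mk_apply]; rfl
  have hq := qpow_one_pow_four
  fin_cases i <;> fin_cases j <;>
    simp [(ketBasis_repr hα _).1, (ketBasis_repr hα _).2, hk, b1sq_mul_apply_fst,
      b1sq_mul_apply_snd,
      ket_zero_fst, ket_one_fst, ket_one_snd, ket_zero_snd, ket_zero_trd, ket_one_trd]
  · rw [sub_eq_zero]
    have e1 : qbr (1 - α) * qpow (-1) = qpow (-α) - qpow 1 ^ 6 * qpow α := by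
      rw [qbr, neg_sub, qpow_sub, qpow_sub, qpow_neg_one]
      linear_combination -qpow (-α) * hq
    have e2 : qpow (-α) * qpow α = 1 := by rw [← qpow_add]; simp [qpow_zero]
    rw [qpow_sub, qpow_add, qpow_neg_three, qpow_three, ← mul_div_assoc,
      ← mul_div_assoc, e1, ← add_div, ← mul_div_assoc]
    congr 1
    linear_combination (qpow 1 ^ 7 + qpow 1 ^ 3) * e2 + qpow 1 ^ 3 * hq
  · have h1 := qnum_one_sub_ne_zero hα
    have e1 : qbr (1 - α) = qbr 1 * qnum (1 - α) := (mul_div_cancel₀ _ qbr_one_ne_zero).symm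
    have e2 : qbr 1 = qpow 1 + qpow 1 ^ 3 := by rw [qbr, qpow_neg_one]; ring
    have e3 := qpow_ne_zero 1
    rw [e1, e2, qpow_sub, qpow_sub, qpow_neg_three, qpow_three]
    field_simp
    ring

/-- If a normalized matrix is unitary, then the normalization is invertible, and it only rescales
the off-diagonal entries. -/
theorem normalizedMatrix_eq {α : ℝ} (hα : ∀ n : ℤ, α ≠ n) (T : H1 α →ₗ[ℂ] H1 α)
    (hT : normalizedMatrix hα T ∈ Matrix.unitaryGroup (Fin 2) ℂ) {a b c d : ℂ}
    (h : LinearMap.toMatrix (ketBasis hα) (ketBasis hα) T = !![a, b; c, d]) :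
    ∃ r : ℂ, r ≠ 0 ∧ normalizedMatrix hα T = !![a, r * b; r⁻¹ * c, d] := by
  -- The inverse of a singular matrix is `0` by convention, and then `normalizedMatrix` would vanish.
  have hdet : IsUnit (normalizer α).det := by
    by_contra h0
    rw [normalizedMatrix, Matrix.nonsing_inv_apply_not_isUnit _ h0, mul_zero,
      Matrix.mem_unitaryGroup_iff, zero_mul] at hT
    exact zero_ne_one hT
  rw [normalizedMatrix, h, normalizer] at *
  rw [Matrix.det_diagonal, Fin.prod_univ_two, isUnit_iff_ne_zero] at hdet
  set x : Fin 2 → ℂ := fun i => braket α i i ^ (1 / 2 : ℂ)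
  have h0 : x 0 ≠ 0 := left_ne_zero_of_mul hdet
  have h1 : x 1 ≠ 0 := right_ne_zero_of_mul hdet
  have hinv : (Matrix.diagonal x)⁻¹ = Matrix.diagonal fun i => (x i)⁻¹ := by
    refine Matrix.inv_eq_right_inv ?_
    rw [Matrix.diagonal_mul_diagonal, ← Matrix.diagonal_one]
    congr 1
    ext i
    fin_cases i <;> simp [h0, h1]
  refine ⟨x 0 / x 1, div_ne_zero h0 h1, ?_⟩
  rw [hinv]
  ext i j
  fin_cases i <;> fin_cases j <;> simp [Matrix.diagonal_mul, Matrix.mul_diagonal] <;> field_simp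

/-! ### The two generators as rotations -/

theorem qpow_ofReal (x : ℝ) :
    qpow x = (Real.cos (Real.pi * x / 4) : ℂ) + (Real.sin (Real.pi * x / 4) : ℂ) * Complex.I := by
  rw [qpow, Complex.ofReal_cos, Complex.ofReal_sin, ← Complex.exp_mul_I]
  congr 1
  push_cast
  ring

theorem star_qpow (x : ℝ) : star (qpow x) = qpow (-x) := by
  have h := qpow_ofReal (-x)
  rw [Complex.ofReal_neg] at h
  rw [h, qpow_ofReal]
  apply Complex.ext <;> simp [neg_div, -Complex.ofReal_cos, -Complex.ofReal_sin]

theorem star_qpow_mul (x : ℝ) : star (qpow x) * qpow x = 1 := by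
  rw [star_qpow, ← qpow_add]; simp [qpow_zero]

theorem qbr_ofReal (x : ℝ) : qbr x = 2 * (Real.sin (Real.pi * x / 4) : ℂ) * Complex.I := by
  rw [qbr, ← star_qpow, qpow_ofReal]
  apply Complex.ext <;> simp [-Complex.ofReal_cos, -Complex.ofReal_sin]
  ring

theorem qbr_one : qbr 1 = (√2 : ℝ) * Complex.I := by
  have h := qbr_ofReal 1
  rw [mul_one, Real.sin_pi_div_four] at h
  push_cast at h
  rw [h]
  ring

theorem sin_ne_zero {α : ℝ} (hα : ∀ n : ℤ, α ≠ n) : Real.sin (Real.pi * α / 4) ≠ 0 := by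
  intro h
  refine qbr_ne_zero hα ?_
  rw [qbr_ofReal, h]
  simp

theorem qnum_ofReal (x : ℝ) : qnum x = (√2 : ℝ) * (Real.sin (Real.pi * x / 4) : ℂ) := by
  have h : ((√2 : ℝ) : ℂ) * (√2 : ℝ) = 2 := by
    rw [← Complex.ofReal_mul, Real.mul_self_sqrt (by norm_num)]; norm_num
  have h0 : ((√2 : ℝ) : ℂ) ≠ 0 := by
    intro h1; rw [h1] at h; norm_num at h
  rw [qnum, qbr_ofReal, qbr_one, div_eq_iff (mul_ne_zero h0 Complex.I_ne_zero)]
  linear_combination -(Real.sin (Real.pi * x / 4) : ℂ) * Complex.I * h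

theorem smul_mem_unitaryGroup {U : Matrix (Fin 2) (Fin 2) ℂ}
    (hU : U ∈ Matrix.unitaryGroup (Fin 2) ℂ) {c : ℂ} (hc : star c * c = 1) :
    c • U ∈ Matrix.unitaryGroup (Fin 2) ℂ := by
  rw [Matrix.mem_unitaryGroup_iff'] at *
  rw [star_smul, smul_mul_smul_comm, hU, hc, one_smul]

/-- An element of `SU(2)` of trace `√2` is the quarter turn about a unit vector. -/
theorem su2_eq_quarterTurn {U : Matrix (Fin 2) (Fin 2) ℂ}
    (hU : U ∈ Matrix.specialUnitaryGroup (Fin 2) ℂ) (htr : U 0 0 + U 1 1 = (√2 : ℝ)) :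
    ∃ n : Fin 3 → ℝ, n ⬝ᵥ n = 1 ∧ n 0 = √2 * (U 0 0).im ∧
      U = (((√2)⁻¹ : ℝ) : ℂ) • (1 + imQuat n) := by
  obtain ⟨h11, h10⟩ := su2_apply hU
  have hs : √2 * √2 = 2 := Real.mul_self_sqrt (by norm_num)
  have hs0 : √2 ≠ 0 := by positivity
  have hre : (U 0 0).re = (√2)⁻¹ := by
    rw [h11] at htr
    have := congrArg Complex.re htr
    simp at this
    field_simp
    linear_combination √2 / 2 * this + hs / 2
  have hdet := (Matrix.mem_specialUnitaryGroup_iff.1 hU).2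
  rw [Matrix.det_fin_two, h11, h10] at hdet
  have hd := congrArg Complex.re hdet
  simp at hd
  have hinv : (√2)⁻¹ * (√2)⁻¹ = 1 / 2 := by rw [← mul_inv, hs]; norm_num
  rw [hre] at hd
  refine ⟨![√2 * (U 0 0).im, √2 * (U 0 1).re, √2 * (U 0 1).im], ?_, rfl, ?_⟩
  · simp only [dotProduct, Fin.sum_univ_three, Matrix.cons_val]
    linear_combination 2 * hd - 2 * hinv +
      ((U 0 0).im ^ 2 + (U 0 1).re ^ 2 + (U 0 1).im ^ 2) * hs
  · ext i j
    fin_cases i <;> fin_cases j <;> apply Complex.ext <;>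
      simp [imQuat, h11, h10, hre] <;> grind

/-- `diag(q ^ α, q ^ (-α))` acts on imaginary quaternions as the rotation by `π α / 2` about the first
axis. -/
theorem diagonal_conj_imQuat (α : ℝ) (n : Fin 3 → ℝ) :
    !![qpow α, 0; 0, qpow (-α)] * imQuat n * star !![qpow α, 0; 0, qpow (-α)]
      = imQuat ![n 0, Real.cos (Real.pi * α / 2) * n 1 - Real.sin (Real.pi * α / 2) * n 2,
          Real.sin (Real.pi * α / 2) * n 1 + Real.cos (Real.pi * α / 2) * n 2] := by
  have h1 : qpow α * qpow (-α) = 1 := by rw [← qpow_add]; simp [qpow_zero]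
  have h2 : qpow α * qpow α = (Real.cos (Real.pi * α / 2) : ℂ) +
      (Real.sin (Real.pi * α / 2) : ℂ) * Complex.I := by
    have h := qpow_ofReal (2 * α)
    rw [show Real.pi * (2 * α) / 4 = Real.pi * α / 2 by ring] at h
    rw [← h, ← qpow_add]
    push_cast
    ring_nf
  have h3 : qpow (-α) * qpow (-α) = (Real.cos (Real.pi * α / 2) : ℂ) -
      (Real.sin (Real.pi * α / 2) : ℂ) * Complex.I := by
    have h := congrArg star h2
    rw [star_mul, star_qpow] at h
    rw [h]
    simp [-Complex.ofReal_cos, -Complex.ofReal_sin, sub_eq_add_neg]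
  have s1 := star_qpow α
  have s2 := star_qpow (-α)
  push_cast at s2
  rw [neg_neg] at s2
  have hI := Complex.I_mul_I
  rw [Complex.star_def] at s1 s2
  ext i j
  fin_cases i <;> fin_cases j <;>
    simp [imQuat, Matrix.mul_apply, s1, s2, -Complex.ofReal_cos, -Complex.ofReal_sin] <;> grind

theorem cos_half_pi_mul {α : ℝ} (hα : ∀ n : ℤ, α ≠ n) :
    Real.cos (Real.pi * α / 2) ≠ 0 ∧ Real.cos (Real.pi * α / 2) ^ 2 ≠ 1 := by
  have h : Real.sin (Real.pi * α) ≠ 0 := by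
    intro h
    obtain ⟨n, hn⟩ := Real.sin_eq_zero_iff.1 h
    refine hα n (mul_left_cancel₀ Real.pi_ne_zero ?_)
    linarith
  rw [show Real.pi * α = 2 * (Real.pi * α / 2) by ring, Real.sin_two_mul] at h
  refine ⟨right_ne_zero_of_mul h, fun h1 => ?_⟩
  have h2 : Real.sin (Real.pi * α / 2) ^ 2 = 0 := by
    have := Real.sin_sq_add_cos_sq (Real.pi * α / 2)
    linarith
  rw [pow_eq_zero_iff two_ne_zero] at h2
  simp [h2] at h

/-- The exceptional values `α ≡ 2 ± 2/3` make `J₁` a rotation of order `3`. -/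
theorem cos_half_pi_mul_ne_neg_half {α : ℝ} (h1 : ∀ n : ℤ, α ≠ 2 + 2 / 3 + 4 * n)
    (h2 : ∀ n : ℤ, α ≠ 2 - 2 / 3 + 4 * n) : Real.cos (Real.pi * α / 2) ≠ -1 / 2 := by
  intro h
  have h3 : Real.cos (2 * Real.pi / 3) = -1 / 2 := by
    rw [show 2 * Real.pi / 3 = Real.pi - Real.pi / 3 by ring, Real.cos_pi_sub,
      Real.cos_pi_div_three]
    norm_num
  rw [← h3, Real.cos_eq_cos_iff] at h
  obtain ⟨k, hk | hk⟩ := h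
  · refine h2 (-k) (mul_left_cancel₀ Real.pi_ne_zero ?_)
    push_cast
    linarith
  · refine h1 (k - 1) (mul_left_cancel₀ Real.pi_ne_zero ?_)
    push_cast
    linarith

/-- The rescaled matrices are a rotation about the first axis and a quarter turn about an axis that
the rotation moves to one neither parallel nor orthogonal to it. -/
theorem exists_dense_closure {α : ℝ} (hα : ∀ n : ℤ, α ≠ n)
    (hJ : J1norm hα ∈ Matrix.unitaryGroup (Fin 2) ℂ)
    (hb : b2norm hα ∈ Matrix.unitaryGroup (Fin 2) ℂ)
    (h1 : ∀ n : ℤ, α ≠ 2 + 2 / 3 + 4 * n) (h2 : ∀ n : ℤ, α ≠ 2 - 2 / 3 + 4 * n) :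
    ∃ A B : Matrix.specialUnitaryGroup (Fin 2) ℂ,
      (A : Matrix (Fin 2) (Fin 2) ℂ) = (-qpow 1) • J1norm hα ∧
      (B : Matrix (Fin 2) (Fin 2) ℂ) = qpow (-3 / 2) • b2norm hα ∧
      Dense ((Subgroup.closure {A, B} : Subgroup (Matrix.specialUnitaryGroup (Fin 2) ℂ)) :
        Set (Matrix.specialUnitaryGroup (Fin 2) ℂ)) := by
  obtain ⟨r, -, eJ⟩ := normalizedMatrix_eq hα _ hJ (toMatrix_J1op hα)
  obtain ⟨s, hs, eb⟩ := normalizedMatrix_eq hα _ hb (toMatrix_b2op hα)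
  have eA : (-qpow 1) • J1norm hα = !![qpow α, 0; 0, qpow (-α)] := by
    have hq := qpow_one_pow_four
    rw [J1norm, eJ, mul_zero, mul_zero, qpow_sub, qpow_add, qpow_three]
    ext i j
    fin_cases i <;> fin_cases j <;> simp
    · linear_combination -qpow α * hq
    · linear_combination -qpow (-α) * hq
  have hA : (-qpow 1) • J1norm hα ∈ Matrix.specialUnitaryGroup (Fin 2) ℂ := by
    refine Matrix.mem_specialUnitaryGroup_iff.2 ⟨smul_mem_unitaryGroup hJ ?_, ?_⟩
    · have := star_qpow_mul 1
      rw [Complex.ofReal_one] at this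
      rw [star_neg, neg_mul_neg, this]
    · rw [eA, Matrix.det_fin_two_of, ← qpow_add]
      simp [qpow_zero]
  have hq2 : qpow (-3 / 2) * qpow (-1 / 2) = -Complex.I := by
    rw [← qpow_add, show (-3 / 2 + -1 / 2 : ℂ) = -2 by norm_num, qpow_neg, qpow_two,
      Complex.inv_I]
  have hI := Complex.I_mul_I
  set η := -qpow (-α) / qnum α with hη
  have eB : qpow (-3 / 2) • b2norm hα = !![-Complex.I * η, -Complex.I * s;
      -Complex.I * (s⁻¹ * (1 + qbr 1 * η - η ^ 2)), -Complex.I * (qbr 1 - η)] := by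
    rw [b2norm, eb, ← hq2]
    ext i j
    fin_cases i <;> fin_cases j <;> simp <;> ring
  have hB : qpow (-3 / 2) • b2norm hα ∈ Matrix.specialUnitaryGroup (Fin 2) ℂ := by
    refine Matrix.mem_specialUnitaryGroup_iff.2 ⟨smul_mem_unitaryGroup hb ?_, ?_⟩
    · have := star_qpow_mul (-3 / 2)
      push_cast at this
      exact this
    · rw [eB, Matrix.det_fin_two_of]
      field_simp
      linear_combination -hI
  obtain ⟨n, hn, hn0, eBn⟩ := su2_eq_quarterTurn hB (by
    rw [eB]
    simp only [Matrix.of_apply, Matrix.cons_val, qbr_one]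
    linear_combination -((√2 : ℝ) : ℂ) * hI)
  -- The first coordinate of the axis of `b₂` is `cot θ`; it comes from the upper left entry of
  -- `b₂`, which the normalization does not affect.
  have hcot : Real.sin (Real.pi * α / 4) * n 0 = Real.cos (Real.pi * α / 4) := by
    have hsin := sin_ne_zero hα
    have e : (-Complex.I * η) * ((√2 : ℝ) * (Real.sin (Real.pi * α / 4) : ℂ)) =
        Real.sin (Real.pi * α / 4) + Real.cos (Real.pi * α / 4) * Complex.I := by
      have hne : ((√2 : ℝ) : ℂ) * (Real.sin (Real.pi * α / 4) : ℂ) ≠ 0 := by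
        rw [← qnum_ofReal]; exact qnum_ne_zero hα
      rw [hη, ← star_qpow, qpow_ofReal, qnum_ofReal, mul_assoc, div_mul_cancel₀ _ hne]
      apply Complex.ext <;> simp [-Complex.ofReal_cos, -Complex.ofReal_sin]
    have him := congrArg Complex.im e
    rw [← Complex.ofReal_mul, Complex.im_mul_ofReal] at him
    rw [hn0, eB]
    simp [-Complex.ofReal_cos, -Complex.ofReal_sin] at him ⊢
    linarith
  obtain ⟨c0, c1⟩ := cos_half_pi_mul hα
  have c2 := cos_half_pi_mul_ne_neg_half h1 h2
  refine ⟨⟨_, hA⟩, ⟨_, hB⟩, rfl, rfl, ?_⟩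
  have hconj := diagonal_conj_imQuat α n
  set w : Fin 3 → ℝ := ![n 0, Real.cos (Real.pi * α / 2) * n 1 - Real.sin (Real.pi * α / 2) * n 2,
    Real.sin (Real.pi * α / 2) * n 1 + Real.cos (Real.pi * α / 2) * n 2] with hw
  have hnw : n ⬝ᵥ w = n 0 ^ 2 + (1 - n 0 ^ 2) * Real.cos (Real.pi * α / 2) := by
    rw [← hn]
    simp only [hw, dotProduct, Fin.sum_univ_three, Matrix.cons_val]
    ring
  set C := Real.cos (Real.pi * α / 2) with hC
  have hcos : 2 * Real.cos (Real.pi * α / 4) ^ 2 = 1 + C := by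
    rw [hC, show Real.pi * α / 2 = 2 * (Real.pi * α / 4) by ring, Real.cos_two_mul]; ring
  have hsin := Real.sin_sq_add_cos_sq (Real.pi * α / 4)
  have hdot : (1 - C) * (n ⬝ᵥ w) = 1 + C - 2 * C ^ 2 := by
    have e : (1 - C) * n 0 ^ 2 = 1 + C := by
      have h5 : 2 * Real.sin (Real.pi * α / 4) ^ 2 = 1 - C := by linarith
      rw [← h5, ← hcos, ← hcot]
      ring
    rw [hnw]
    linear_combination (1 - C) * e
  have hC1 : C ≠ 1 := fun h => c1 (by rw [h]; norm_num)
  refine dense_closure_of_quarterTurn _ _ hn eBn (by rw [← hconj, ← eA]) ?_ ?_ ?_ <;> intro ht <;>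
    rw [ht] at hdot
  · have : (C - 1) * (2 * C + 1) = 0 := by linear_combination hdot
    rcases mul_eq_zero.1 this with h | h
    · exact hC1 (by linarith)
    · exact c2 (by linarith)
  · have : C * (C - 1) = 0 := by linear_combination hdot / 2
    rcases mul_eq_zero.1 this with h | h
    · exact c0 h
    · exact hC1 (by linarith)
  · exact c1 (by linear_combination hdot / 2)

end NonssIsing

theorem mainTheorem1 (α : ℝ) (hα : ∀ n : ℤ, α ≠ n)
    (hJ : NonssIsing.J1norm hα ∈ Matrix.unitaryGroup (Fin 2) ℂ)
    (hb : NonssIsing.b2norm hα ∈ Matrix.unitaryGroup (Fin 2) ℂ)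
    (h1 : ∀ n : ℤ, α ≠ 2 + 2 / 3 + 4 * n) (h2 : ∀ n : ℤ, α ≠ 2 - 2 / 3 + 4 * n)
    (h3 : ∀ n : ℤ, α ≠ 2 + 3 / 5 + 4 * n) (h4 : ∀ n : ℤ, α ≠ 2 - 3 / 5 + 4 * n) :
    ∃ A B : Matrix.specialUnitaryGroup (Fin 2) ℂ,
      (A : Matrix (Fin 2) (Fin 2) ℂ) = (-NonssIsing.qpow 1) • NonssIsing.J1norm hα ∧
      (B : Matrix (Fin 2) (Fin 2) ℂ) = NonssIsing.qpow (-3 / 2) • NonssIsing.b2norm hα ∧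
      Dense ((Subgroup.closure {A, B} : Subgroup (Matrix.specialUnitaryGroup (Fin 2) ℂ)) :
        Set (Matrix.specialUnitaryGroup (Fin 2) ℂ)) := by
  exact NonssIsing.exists_dense_closure hα hJ hb h1 h2
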